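/- Let $a,b$ and $l$ be integers with $a,b\ge1$ and $l\ge0$, and let $\alpha=\{\alpha_1<\dots<\alpha_r\}\subseteq\{1,\dots,a\}$ and $\beta=\{\beta_1<\dots<\beta_r\}\subseteq\{1,\dots,b\}$ be sets of equal cardinality $r\ge0$. *Osculating paths.* Regard $[a]\times[b]=\{1,\dots,a\}\times\{1,\dots,b\}$ as a rectangle of lattice points, $(i,j)$ being the point in row $i$ (numbered from top to bottom) and column $j$ (numbered from left to right). Let $OP(a,b,\alpha,\beta,l)$ be the set of $r$-tuples $P=(P_1,\dots,P_r)$ such that: - $P_k$ is a lattice path from $(a,\beta_k)$ to $(\alpha_k,b)$ with steps $(0,1)$ and $(-1,0)$, for each $k$; - for each $k<r$, the paths $P_k$ and $P_{k+1}$ are osculating, i.e., whenever both pass through a point $(i,j)$, the path $P_k$ passes through $(i,j-1)$ immediately before and $(i-1,j)$ immediately after $(i,j)$, and $P_{k+1}$ passes through $(i+1,j)$ immediately before $(i,j)$ (unless it starts at $(i,j)$) and $(i,j+1)$ immediately after $(i,j)$ (unless it ends at $(i,j)$); - there are exactly $l$ points which are either vacancies of $P$ (points of $[a]\times[b]$ through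 which no path of $P$ passes) or osculations of $P$ (points common to two different paths of $P$). *The partition.* For integers $\gamma_1>\dots>\gamma_r\ge0$ and $\delta_1>\dots>\delta_r\ge0$, let $(\gamma_1,\dots,\gamma_r\,|\,\delta_1,\dots,\delta_r)$ be the partition, in Frobenius notation, whose Young diagram has exactly $r$ squares on its main diagonal, with $\gamma_k$ squares to the right of, and $\delta_k$ squares below, the $k$-th of these. Let $\mu=(b-\beta_1,\dots,b-\beta_r\,|\,a-\alpha_1,\dots,a-\alpha_r)$; it has at most $a$ parts, each at most $b$. Let $\lambda_{a,b,\alpha,\beta}=(b-\mu_a,b-\mu_{a-1},\dots,b-\mu_1)$ be its complement in the $a\times b$ rectangle. *Oscillating tableaux.* For a partition $\lambda$, let $OT(\lambda,l)$ be the set of oscillating tableaux of shape $\lambda$ and length $l$, i.e., sequences of partitions $\eta=(\eta_0=\emptyset,\eta_1,\dots,\eta_l=\lambda)$ in which the Young diagrams of $\eta_{k-1}$ and $\eta_k$ differ by exactly one square for each $1\le k\le l$. Let $\Omega(\eta)_k=j-i$ be the content of that square, where $i$ is its row and $j$ its column. For a total strict order $\prec$ on $\mathbb Z$, let $\mathrm{asc}(\prec,\eta)$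 be the number of $k$ with $1\le k\le l-1$ and $\Omega(\eta)_k\prec\Omega(\eta)_{k+1}$. *The result.* For an integer $q$, a $q$-order is a total strict order $\prec$ on $\mathbb Z$ such that $z\prec z'$ whenever $z<z'\le q$ or $z>z'\ge q$. For every $(b-a)$-order $\prec$, the sets below are finite and $$|OP(a,b,\alpha,\beta,l)|=\sum_{\eta\in OT(\lambda_{a,b,\alpha,\beta},\,l)}\binom{\min(a,b)+\mathrm{asc}(\prec,\eta)}{l}.$$ -/

import Mathlib

namespace Osculating

/-! ### Boundary points and osculating paths -/

/-- Pairs `(α, β)` with `α ⊆ [a]`, `β ⊆ [b]` and `|α| = |β|`. -/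
structure BoundaryPair (a b : ℕ) where
  α : Finset ℕ
  β : Finset ℕ
  α_subset : α ⊆ Finset.Icc 1 a
  β_subset : β ⊆ Finset.Icc 1 b
  card_eq : β.card = α.card

namespace BoundaryPair

variable {a b : ℕ} (B : BoundaryPair a b)

/-- The common cardinality `r` of `α` and `β`. -/
def r : ℕ := B.α.card

/-- The elements `α_1 < ⋯ < α_r` of `α` in increasing order, indexed from `0`. -/
def row (k : Fin B.r) : ℕ := B.α.orderEmbOfFin rfl k

/-- The elements `β_1 < ⋯ < β_r` of `β` in increasing order, indexed from `0`. -/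
def col (k : Fin B.r) : ℕ := B.β.orderEmbOfFin B.card_eq k

theorem row_le (k : Fin B.r) : B.row k ≤ a :=
  (Finset.mem_Icc.1 (B.α_subset (B.α.orderEmbOfFin_mem rfl k))).2

theorem col_le (k : Fin B.r) : B.col k ≤ b :=
  (Finset.mem_Icc.1 (B.β_subset (B.β.orderEmbOfFin_mem B.card_eq k))).2

theorem row_strictMono : StrictMono B.row := (B.α.orderEmbOfFin rfl).strictMono

theorem col_strictMono : StrictMono B.col := (B.β.orderEmbOfFin B.card_eq).strictMono

end BoundaryPair

/-- A single step of a path: `(0, 1)` (rightwards) or `(-1, 0)` (upwards).  Points are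
`(row, column)`, rows being numbered from top to bottom. -/
def Step (p q : ℤ × ℤ) : Prop := q - p = (0, 1) ∨ q - p = (-1, 0)

/-- `P` is the list of successive points of a lattice path from `s` to `e`. -/
def IsPath (s e : ℤ × ℤ) (P : List (ℤ × ℤ)) : Prop :=
  P.head? = some s ∧ P.getLast? = some e ∧ P.IsChain Step

/-- `P` and `P'` (where `P` is the path with the smaller start column and smaller end row) are
osculating: at any common point `(i, j)`, `P` arrives from the left and leaves upwards, while `P'`
arrives from below (unless it starts there) and leaves to the right (unless it ends there). -/
def AreOsculating (P P' : List (ℤ × ℤ)) : Prop :=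
  ∀ (m n : ℕ) (i j : ℤ), P[m]? = some (i, j) → P'[n]? = some (i, j) →
    (m ≠ 0 ∧ P[m - 1]? = some (i, j - 1)) ∧
    P[m + 1]? = some (i - 1, j) ∧
    (n ≠ 0 → P'[n - 1]? = some (i + 1, j)) ∧
    (n + 1 ≠ P'.length → P'[n + 1]? = some (i, j + 1))

/-- The set of `r`-tuples of osculating paths whose `k`-th path goes from `(a, β_k)` to
`(α_k, b)`. -/
def OP (a b : ℕ) (B : BoundaryPair a b) : Set (Fin B.r → List (ℤ × ℤ)) :=
  {P | (∀ k, IsPath ((a : ℤ), (B.col k : ℤ)) ((B.row k : ℤ), (b : ℤ)) (P k)) ∧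
    ∀ (k : Fin B.r) (h : (k : ℕ) + 1 < B.r), AreOsculating (P k) (P ⟨k + 1, h⟩)}

/-- The vacancies of `P`: the points of `[a] × [b]` through which no path passes. -/
def vacancies (a b : ℕ) {r : ℕ} (P : Fin r → List (ℤ × ℤ)) : Set (ℤ × ℤ) :=
  {p | (p.1 ∈ Set.Icc 1 (a : ℤ) ∧ p.2 ∈ Set.Icc 1 (b : ℤ)) ∧ ∀ k, p ∉ P k}

/-- The osculations of `P`: the common points of two different paths. -/
def osculations {r : ℕ} (P : Fin r → List (ℤ × ℤ)) : Set (ℤ × ℤ) :=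
  {p | ∃ k k' : Fin r, k ≠ k' ∧ p ∈ P k ∧ p ∈ P k'}

/-- The vacancy-osculation set `Z(P)`. -/
def vacOsc (a b : ℕ) {r : ℕ} (P : Fin r → List (ℤ × ℤ)) : Set (ℤ × ℤ) :=
  vacancies a b P ∪ osculations P

/-- The tuples of osculating paths with exactly `l` vacancy-osculations. -/
def OPl (a b : ℕ) (B : BoundaryPair a b) (l : ℕ) : Set (Fin B.r → List (ℤ × ℤ)) :=
  {P | P ∈ OP a b B ∧ (vacOsc a b P).encard = (l : ℕ∞)}

/-! ### Partitions

Partitions are represented by their Young diagrams; Mathlib numbers rows and columns from `0`,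
which does not affect the content `j - i` of a square. -/

/-- The partition with Frobenius notation `(γ_1, …, γ_r | δ_1, …, δ_r)`: its diagonal squares are
the first `r`, and there are `γ_k` squares to the right of and `δ_k` squares below the `k`-th. -/
def frobenius {r : ℕ} (γ δ : Fin r → ℕ) (hγ : StrictAnti γ) (hδ : StrictAnti δ) :
    YoungDiagram where
  cells := Finset.univ.biUnion fun k : Fin r =>
    (Finset.range (γ k + 1)).image (fun t => ((k : ℕ), (k : ℕ) + t)) ∪
      (Finset.range (δ k + 1)).image (fun t => ((k : ℕ) + t, (k : ℕ)))
  isLowerSet := by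
    have key : ∀ f : Fin r → ℕ, StrictAnti f → ∀ k m : Fin r, m ≤ k → k + f k ≤ m + f m := by
      intro f hf
      have h : ∀ (n : ℕ) (k m : Fin r), (k : ℕ) = m + n → k + f k ≤ m + f m := by
        intro n
        induction n with
        | zero =>
          intro k m h
          obtain rfl : k = m := Fin.ext h
          exact le_rfl
        | succ n ih =>
          intro k m h
          have hlt : (m : ℕ) + n < r := by omega
          have h1 := ih ⟨m + n, hlt⟩ m rfl
          have h2 : f k < f ⟨m + n, hlt⟩ := hf (Fin.mk_lt_of_lt_val (by omega))
          simp only at h1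
          omega
      intro k m hmk
      exact h (k - m) k m (by have : (m : ℕ) ≤ k := hmk; omega)
    rintro ⟨i, j⟩ ⟨i', j'⟩ ⟨hi, hj⟩ hmem
    simp only at hi hj
    simp only [Finset.coe_biUnion, Finset.coe_univ, Set.mem_univ, Set.iUnion_true, Set.mem_iUnion,
      Finset.coe_union, Finset.coe_image, Finset.coe_range, Set.mem_union, Set.mem_image,
      Set.mem_Iio, Prod.mk.injEq] at hmem ⊢
    have hk : ∃ k : Fin r, (i ≤ k + δ k ∧ j ≤ k) ∨ (i ≤ k ∧ j ≤ k + γ k) := by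
      obtain ⟨k, ⟨t, ht, h1, h2⟩ | ⟨t, ht, h1, h2⟩⟩ := hmem
      · exact ⟨k, Or.inr ⟨by omega, by omega⟩⟩
      · exact ⟨k, Or.inl ⟨by omega, by omega⟩⟩
    obtain ⟨k, hk⟩ := hk
    rcases le_total i' j' with hij | hij
    · have hik : i' ≤ k := by omega
      have hlt : i' < r := by omega
      have h1 := key γ hγ k ⟨i', hlt⟩ hik
      simp only at h1
      exact ⟨⟨i', hlt⟩, Or.inl ⟨j' - i', by omega, rfl, by simp only; omega⟩⟩
    · have hjk : j' ≤ k := by omega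
      have hlt : j' < r := by omega
      have h1 := key δ hδ k ⟨j', hlt⟩ hjk
      simp only at h1
      exact ⟨⟨j', hlt⟩, Or.inr ⟨i' - j', by omega, by simp only; omega, rfl⟩⟩

/-- The `(a, b)`-complement `(b - μ_a, …, b - μ_1)` of a partition `μ`. -/
def complement (a b : ℕ) (μ : YoungDiagram) : YoungDiagram where
  cells := (Finset.range a ×ˢ Finset.range b).filter
    fun c => (a - 1 - c.1, b - 1 - c.2) ∉ μ.cells
  isLowerSet := by
    rintro ⟨i, j⟩ ⟨i', j'⟩ ⟨hi, hj⟩ hmem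
    simp only at hi hj
    simp only [Finset.coe_filter, Finset.mem_product, Finset.mem_range, Set.mem_ofPred_eq]
      at hmem ⊢
    refine ⟨⟨by omega, by omega⟩, fun h => hmem.2 ?_⟩
    exact μ.isLowerSet (show (a - 1 - i, b - 1 - j) ≤ (a - 1 - i', b - 1 - j') from
      ⟨by simp only; omega, by simp only; omega⟩) h

/-- The partition `λ_{a,b,α,β}`, namely the `(a, b)`-complement of
`(b - β_1, …, b - β_r | a - α_1, …, a - α_r)`. -/
def shape (a b : ℕ) (B : BoundaryPair a b) : YoungDiagram :=
  complement a b
    (frobenius (fun k => b - B.col k) (fun k => a - B.row k)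
      (fun k m h => by
        have h1 := B.col_strictMono h
        have h2 := B.col_le m
        simp only
        omega)
      (fun k m h => by
        have h1 := B.row_strictMono h
        have h2 := B.row_le m
        simp only
        omega))

/-! ### Oscillating tableaux -/

/-- `μ ∼ ν`: the Young diagrams of `μ` and `ν` differ by exactly one square. -/
def DifferBySquare (μ ν : YoungDiagram) : Prop :=
  ∃ c : ℕ × ℕ, symmDiff μ.cells ν.cells = {c}

/-- The diagonal difference of `μ` and `ν`; if `μ ∼ ν`, the sum has a single term and is the
content of the square by which the two diagrams differ. -/
def diagDiff (μ ν : YoungDiagram) : ℤ :=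
  ∑ c ∈ symmDiff μ.cells ν.cells, ((c.2 : ℤ) - (c.1 : ℤ))

/-- The oscillating tableaux of shape `μ` and length `l`. -/
def OT (μ : YoungDiagram) (l : ℕ) : Set (Fin (l + 1) → YoungDiagram) :=
  {η | η 0 = ⊥ ∧ η (Fin.last l) = μ ∧ ∀ k : Fin l, DifferBySquare (η k.castSucc) (η k.succ)}

/-- The profile of `η`: the sequence of successive diagonal differences. -/
def profile {l : ℕ} (η : Fin (l + 1) → YoungDiagram) (k : Fin l) : ℤ :=
  diagDiff (η k.castSucc) (η k.succ)

/-- The set of ascents of `η` with respect to `prec` (positions numbered from `0`). -/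
def ascents (prec : ℤ → ℤ → Prop) {l : ℕ} (η : Fin (l + 1) → YoungDiagram) : Set (Fin l) :=
  {k | ∃ h : (k : ℕ) + 1 < l, prec (profile η k) (profile η ⟨k + 1, h⟩)}

/-- The number of ascents of `η` with respect to `prec`. -/
noncomputable def asc (prec : ℤ → ℤ → Prop) {l : ℕ} (η : Fin (l + 1) → YoungDiagram) : ℕ :=
  (ascents prec η).ncard

/-- A `q`-order: a total strict order on `ℤ` with `⋯ ≺ q - 2 ≺ q - 1 ≺ q` and
`⋯ ≺ q + 2 ≺ q + 1 ≺ q`. -/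
structure IsQOrder (q : ℤ) (prec : ℤ → ℤ → Prop) : Prop where
  isStrictTotalOrder : IsStrictTotalOrder ℤ prec
  of_lt_of_le : ∀ z z' : ℤ, z < z' → z' ≤ q → prec z z'
  of_gt_of_ge : ∀ z z' : ℤ, z' < z → q ≤ z' → prec z z'

end Osculating

namespace Osculating

/-! ### Lattice paths and the regions weakly south-east of them -/

/-! Encode `P` by its height function: `h i j` is the number of paths passing weakly above and to
the left of `(i, j)`. The osculation condition says exactly that `h` grows by `0` or `1` along each
unit step right or down (`height_bijOn`). The difference `h i j - h (i - 1) (j - 1)` counts the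
paths through `(i, j)`, so a point is a vacancy or an osculation iff this difference is not `1`
(`vacOsc_eq`).

Subtract `h i j` from `min i j`, truncated at `0`. Along a cut of the rectangle with steps right and
up, the resulting numbers satisfy the relations between consecutive diagonal lengths of a partition
(`adj_right`, `adj_up`). Translate the lower right boundary of the rectangle diagonally towards the
upper left: this gives hooks `t = 0, …, min a b`, hook `0` carrying the empty partition and the last
hook carrying the prescribed shape (`toArray_last`, `diag_shape`). Pass from hook `t` to hook `t +
1` one content at a time, in a `(b - a)`-order, so from the ends of both arms towards the corner.
Every intermediate cut is still such a lattice path, hence a partition, and the state changes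
exactly at vacancies and osculations. Conversely these partition conditions amount to the local
conditions on `h` (`walkValid_positions_iff`, `toArray_bijOn`). Path tuples thus become lazy walks
on partitions with `l` changes.

Forgetting the idle positions leaves an oscillating tableau, which is determined by its word of
contents (`Tog.unique`, `word_bijOn`). It comes from as many lazy walks as its word has occurrences
as a subsequence of `min a b` copies of the sorted list of contents (`ncard_walks`). An occurrence
is a weakly increasing choice of blocks, strictly increasing at non-ascents, whence the binomial
coefficient (`emb_positions`). -/

theorem isPath_singleton (s : ℤ × ℤ) : IsPath s s [s] := by
  simp [IsPath]

theorem IsPath.cons {s s' e : ℤ × ℤ} {P : List (ℤ × ℤ)} (h : IsPath s' e P) (hs : Step s s') :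
    IsPath s e (s :: P) := by
  obtain ⟨h1, h2, h3⟩ := h
  cases P with
  | nil => simp at h1
  | cons x P =>
    simp only [List.head?_cons, Option.some.injEq] at h1
    subst h1
    refine ⟨rfl, by simpa using h2, ?_⟩
    exact List.isChain_cons_cons.2 ⟨hs, h3⟩

/-! ### Points of a path, indexed by content -/

section Path

variable {s e : ℤ × ℤ} {P : List (ℤ × ℤ)}

theorem IsPath.length_pos (h : IsPath s e P) : 0 < P.length := by
  cases P with
  | nil => simp [IsPath] at h
  | cons x P => simp

theorem IsPath.getElem_zero (h : IsPath s e P) : P[0]'h.length_pos = s := by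
  have h1 := h.1
  rw [List.head?_eq_getElem?, List.getElem?_eq_getElem h.length_pos] at h1
  simpa using h1

theorem IsPath.getElem_last (h : IsPath s e P) :
    P[P.length - 1]'(by have := h.length_pos; omega) = e := by
  have h1 := h.2.1
  rw [List.getLast?_eq_getElem?, List.getElem?_eq_getElem (by have := h.length_pos; omega)] at h1
  simpa using h1

theorem IsPath.step (h : IsPath s e P) (n : ℕ) (hn : n + 1 < P.length) :
    (P[n + 1].1 = P[n].1 ∧ P[n + 1].2 = P[n].2 + 1) ∨
      (P[n + 1].1 = P[n].1 - 1 ∧ P[n + 1].2 = P[n].2) := by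
  have h1 := List.isChain_iff_getElem.1 h.2.2 n hn
  rcases h1 with h1 | h1
  · left
    have h2 := congrArg Prod.fst h1
    have h3 := congrArg Prod.snd h1
    simp only [Prod.fst_sub, Prod.snd_sub] at h2 h3
    omega
  · right
    have h2 := congrArg Prod.fst h1
    have h3 := congrArg Prod.snd h1
    simp only [Prod.fst_sub, Prod.snd_sub] at h2 h3
    omega

theorem IsPath.content_getElem (h : IsPath s e P) (n : ℕ) (hn : n < P.length) :
    P[n].2 - P[n].1 = s.2 - s.1 + n := by
  induction n with
  | zero => simp [h.getElem_zero]
  | succ n ih =>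
    have h1 := ih (by omega)
    have h2 := h.step n hn
    push_cast
    omega

theorem IsPath.length_eq (h : IsPath s e P) :
    (P.length : ℤ) = (e.2 - e.1) - (s.2 - s.1) + 1 := by
  have h0 := h.length_pos
  have h1 := h.content_getElem (P.length - 1) (by omega)
  rw [h.getElem_last] at h1
  omega

theorem IsPath.getElem_mono (h : IsPath s e P) (n k : ℕ) (hn : n + k < P.length) :
    P[n + k].1 ≤ P[n].1 ∧ P[n].2 ≤ P[n + k].2 := by
  induction k with
  | zero => simp
  | succ k ih =>
    have h1 := ih (by omega)
    have h2 := h.step (n + k) (by omega)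
    simp only [← add_assoc]
    omega

theorem IsPath.not_lt (h : IsPath s e P) {p q : ℤ × ℤ} (hp : p ∈ P) (hq : q ∈ P) :
    ¬(p.1 < q.1 ∧ p.2 < q.2) := by
  obtain ⟨n, hn, rfl⟩ := List.getElem_of_mem hp
  obtain ⟨k, hk, rfl⟩ := List.getElem_of_mem hq
  rcases le_total n k with hnk | hnk
  · obtain ⟨d, rfl⟩ := Nat.exists_eq_add_of_le hnk
    have := h.getElem_mono n d hk
    omega
  · obtain ⟨d, rfl⟩ := Nat.exists_eq_add_of_le hnk
    have := h.getElem_mono k d hn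
    omega

theorem IsPath.mem_bounds (h : IsPath s e P) {p : ℤ × ℤ} (hp : p ∈ P) :
    e.1 ≤ p.1 ∧ p.1 ≤ s.1 ∧ s.2 ≤ p.2 ∧ p.2 ≤ e.2 := by
  obtain ⟨n, hn, rfl⟩ := List.getElem_of_mem hp
  have h1 := h.getElem_mono 0 n (by omega)
  obtain ⟨d, hd⟩ : ∃ d, P.length - 1 = n + d := Nat.exists_eq_add_of_le (by omega)
  have h2 := h.getElem_mono n d (by omega)
  have h3 := h.getElem_last
  simp only [hd] at h3
  simp only [zero_add, h.getElem_zero] at h1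
  rw [h3] at h2
  omega

theorem IsPath.start_mem (h : IsPath s e P) : s ∈ P :=
  List.mem_of_mem_head? (by simp [h.1])

theorem IsPath.end_mem (h : IsPath s e P) : e ∈ P :=
  List.mem_of_mem_getLast? (by simp [h.2.1])

theorem IsPath.exists_mem_content (h : IsPath s e P) {c : ℤ} (h1 : s.2 - s.1 ≤ c)
    (h2 : c ≤ e.2 - e.1) : ∃ p ∈ P, p.2 - p.1 = c := by
  have hl := h.length_eq
  have hn : (c - (s.2 - s.1)).toNat < P.length := by omega
  refine ⟨_, List.getElem_mem hn, ?_⟩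
  rw [h.content_getElem]
  omega

theorem IsPath.getElem?_eq_some (h : IsPath s e P) {p : ℤ × ℤ} (hp : p ∈ P) (n : ℕ)
    (hn : p.2 - p.1 = s.2 - s.1 + n) : P[n]? = some p := by
  obtain ⟨k, hk, rfl⟩ := List.getElem_of_mem hp
  have h1 := h.content_getElem k hk
  obtain rfl : k = n := by omega
  simp

end Path

/-- The point `(i, j)` lies weakly below and to the right of some point of `P`. -/
def Reg (P : List (ℤ × ℤ)) (i j : ℤ) : Prop := ∃ p ∈ P, p.1 ≤ i ∧ p.2 ≤ j

theorem Reg.mono {P : List (ℤ × ℤ)} {i j i' j' : ℤ} (h : Reg P i j) (hi : i ≤ i') (hj : j ≤ j') :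
    Reg P i' j' := by
  obtain ⟨p, hp, h1, h2⟩ := h
  exact ⟨p, hp, by omega, by omega⟩

theorem reg_of_mem {P : List (ℤ × ℤ)} {i j : ℤ} (h : (i, j) ∈ P) : Reg P i j :=
  ⟨_, h, le_rfl, le_rfl⟩

/-! ### Paths as boundaries of regions; osculation in terms of regions -/

section Region

variable {a b u v : ℤ} {P : List (ℤ × ℤ)}

/-- Compare `(i, j)` with the point of `P` of the same content. If that point is further up, `(i -
1, j - 1)` lies in the region; if it is further down, it is strictly south-east of another point of
`P`, against `not_lt`. -/
theorem IsPath.mem_iff (h : IsPath (a, u) (v, b) P) {i j : ℤ} (hi : i ≤ a) (hj : j ≤ b) :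
    (i, j) ∈ P ↔ Reg P i j ∧ ¬Reg P (i - 1) (j - 1) := by
  constructor
  · intro hm
    refine ⟨reg_of_mem hm, ?_⟩
    rintro ⟨q, hq, h1, h2⟩
    exact h.not_lt hq hm ⟨by simp only; omega, by simp only; omega⟩
  · rintro ⟨⟨q, hq, h1, h2⟩, hn⟩
    have hb := h.mem_bounds hq
    simp only at hb
    obtain ⟨p, hp, hc⟩ := h.exists_mem_content (c := j - i) (by simp only; omega)
      (by simp only; omega)
    rcases lt_trichotomy p.1 i with hlt | heq | hgt
    · exact absurd ⟨p, hp, by omega, by omega⟩ hn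
    · have : p = (i, j) := Prod.ext heq (by simp only; omega)
      exact this ▸ hp
    · exact absurd ⟨by omega, by omega⟩ (h.not_lt hq hp)

theorem IsPath.reg_bottom (h : IsPath (a, u) (v, b) P) (j : ℤ) : Reg P a j ↔ u ≤ j := by
  constructor
  · rintro ⟨p, hp, h1, h2⟩
    have := h.mem_bounds hp
    simp only at this
    omega
  · intro hj
    exact ⟨_, h.start_mem, le_rfl, hj⟩

theorem IsPath.reg_right (h : IsPath (a, u) (v, b) P) (i : ℤ) : Reg P i b ↔ v ≤ i := by
  constructor
  · rintro ⟨p, hp, h1, h2⟩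
    have := h.mem_bounds hp
    simp only at this
    omega
  · intro hj
    exact ⟨_, h.end_mem, hj, le_rfl⟩

theorem IsPath.reg_clamp (h : IsPath (a, u) (v, b) P) (i j : ℤ) :
    Reg P i j ↔ Reg P (min i a) (min j b) := by
  constructor
  · rintro ⟨p, hp, h1, h2⟩
    have := h.mem_bounds hp
    simp only at this
    exact ⟨p, hp, by omega, by omega⟩
  · intro h
    exact h.mono (min_le_left _ _) (min_le_left _ _)

theorem IsPath.le_of_reg (h : IsPath (a, u) (v, b) P) {i j : ℤ} (hr : Reg P i j) :
    v ≤ i ∧ u ≤ j := by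
  obtain ⟨p, hp, h1, h2⟩ := hr
  have := h.mem_bounds hp
  simp only at this
  omega

theorem IsPath.eq_of_reg_iff {Q : List (ℤ × ℤ)} (h : IsPath (a, u) (v, b) P)
    (h' : IsPath (a, u) (v, b) Q) (hr : ∀ i j, i ≤ a → j ≤ b → (Reg P i j ↔ Reg Q i j)) :
    P = Q := by
  have hl := h.length_eq
  have hl' := h'.length_eq
  refine List.ext_getElem (by omega) fun n hn hn' => ?_
  have hm : P[n] ∈ P := List.getElem_mem hn
  have hb := h.mem_bounds hm
  have hc := h.content_getElem n hn
  simp only at hb hc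
  have hm' : P[n] ∈ Q :=
    (h'.mem_iff (i := P[n].1) (j := P[n].2) hb.2.1 hb.2.2.2).2
      (by rw [← hr _ _ (by omega) (by omega), ← hr _ _ (by omega) (by omega)]
          exact (h.mem_iff (i := P[n].1) (j := P[n].2) (by omega) (by omega)).1 hm)
  have := h'.getElem?_eq_some hm' n (by simp only; omega)
  rw [List.getElem?_eq_getElem hn'] at this
  simpa using this.symm

/-- Greedy tracing of the boundary of an up-set: go up while this stays in `R`, otherwise go right.
Here `n` is the number of remaining steps, and `¬R (i - 1) (j - 1)` is the invariant that keeps the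
path on the boundary. -/
theorem exists_isPath_along {R : ℤ → ℤ → Prop}
    (hR : ∀ i j i' j', R i j → i ≤ i' → j ≤ j' → R i' j')
    (hv : ∀ i ≤ a, R i b ↔ v ≤ i) (n : ℕ) :
    ∀ i j : ℤ, i ≤ a → j ≤ b → v ≤ i → b - j + (i - v) = n → R i j → ¬R (i - 1) (j - 1) →
      ∃ P, IsPath (i, j) (v, b) P ∧ ∀ p ∈ P, R p.1 p.2 ∧ ¬R (p.1 - 1) (p.2 - 1) := by
  induction n with
  | zero =>
    intro i j hi hj hvi hn h1 h2
    obtain rfl : i = v := by omega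
    obtain rfl : j = b := by omega
    exact ⟨_, isPath_singleton _, by simpa using ⟨h1, h2⟩⟩
  | succ n ih =>
    intro i j hi hj hvi hn h1 h2
    push_cast at hn
    by_cases hu : R (i - 1) j
    · obtain ⟨P, hP, hP'⟩ := ih (i - 1) j (by omega) hj
        ((hv _ (by omega)).1 (hR _ _ _ _ hu le_rfl hj)) (by omega) hu
        (fun h => h2 (hR _ _ _ _ h (by omega) le_rfl))
      refine ⟨_, hP.cons (Or.inr (by simp)), ?_⟩
      simpa using ⟨⟨h1, h2⟩, by simpa using hP'⟩
    · have hjb : j ≠ b := by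
        rintro rfl
        have := mt (hv (i - 1) (by omega)).2 hu
        omega
      obtain ⟨P, hP, hP'⟩ := ih i (j + 1) hi (by omega) hvi (by omega)
        (hR _ _ _ _ h1 le_rfl (by omega)) (by simpa using hu)
      refine ⟨_, hP.cons (Or.inl (by simp)), ?_⟩
      simpa using ⟨⟨h1, h2⟩, by simpa using hP'⟩

theorem exists_isPath_reg_iff {R : ℤ → ℤ → Prop}
    (hR : ∀ i j i' j', R i j → i ≤ i' → j ≤ j' → R i' j') (hva : v ≤ a) (hub : u ≤ b)
    (hu : ∀ j ≤ b, R a j ↔ u ≤ j) (hv : ∀ i ≤ a, R i b ↔ v ≤ i) :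
    ∃ P, IsPath (a, u) (v, b) P ∧ ∀ i j, i ≤ a → j ≤ b → (Reg P i j ↔ R i j) := by
  obtain ⟨P, hP, hP'⟩ := exists_isPath_along hR hv (b - u + (a - v)).toNat a u le_rfl hub hva
    (by omega) ((hu u hub).2 le_rfl) (fun h => by
      have := (hu (u - 1) (by omega)).1 (hR _ _ _ _ h (by omega) le_rfl)
      omega)
  refine ⟨P, hP, fun i j hi hj => ⟨?_, fun h => ?_⟩⟩
  · rintro ⟨p, hp, h1, h2⟩
    exact hR _ _ _ _ (hP' p hp).1 h1 h2
  · have h1 := (hu j hj).1 (hR _ _ _ _ h hi le_rfl)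
    have h2 := (hv i hi).1 (hR _ _ _ _ h le_rfl hj)
    obtain ⟨p, hp, hc⟩ := hP.exists_mem_content (c := j - i) (by simp only; omega)
      (by simp only; omega)
    rcases le_or_gt p.1 i with hle | hgt
    · exact ⟨p, hp, hle, by omega⟩
    · exact absurd (hR _ _ _ _ h (by omega) (by omega)) (hP' p hp).2

variable {u' v' : ℤ} {Q : List (ℤ × ℤ)}

/-- At a point of `Q` in the region of `P`, either `(i - 1, j - 1)` is also in that region, or the
point is common and osculation puts both `(i - 1, j)` and `(i, j - 1)` on `P`. This also carries the
induction along `Q`: right steps stay in the region trivially, upward steps by the dichotomy. -/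
theorem AreOsculating.reg (hP : IsPath (a, u) (v, b) P) (hQ : IsPath (a, u') (v', b) Q)
    (huu : u ≤ u') (h : AreOsculating P Q) {i j : ℤ} (hr : Reg Q i j) :
    Reg P (i - 1) j ∧ Reg P i (j - 1) := by
  have key : ∀ i j, (i, j) ∈ Q → Reg P i j → Reg P (i - 1) j ∧ Reg P i (j - 1) := by
    intro i j hm hr
    have hb := hQ.mem_bounds hm
    simp only at hb
    by_cases hn : Reg P (i - 1) (j - 1)
    · exact ⟨hn.mono le_rfl (by omega), hn.mono (by omega) le_rfl⟩
    · obtain ⟨m, hm'⟩ := List.getElem?_of_mem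
        ((hP.mem_iff (by omega) (by omega)).2 ⟨hr, hn⟩)
      obtain ⟨n, hn'⟩ := List.getElem?_of_mem hm
      obtain ⟨h1, h2, -⟩ := h m n i j hm' hn'
      exact ⟨reg_of_mem (List.mem_of_getElem? h2), reg_of_mem (List.mem_of_getElem? h1.2)⟩
  have all : ∀ n (hn : n < Q.length), Reg P Q[n].1 Q[n].2 := by
    intro n
    induction n with
    | zero =>
      intro hn
      rw [hQ.getElem_zero]
      exact (hP.reg_bottom _).2 huu
    | succ n ih =>
      intro hn
      have h1 := ih (by omega)
      rcases hQ.step n hn with ⟨h2, h3⟩ | ⟨h2, h3⟩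
      · exact h1.mono (by omega) (by omega)
      · rw [h2, h3]
        exact (key _ _ (List.getElem_mem _) h1).1
  obtain ⟨q, hq, h1, h2⟩ := hr
  obtain ⟨n, hn, rfl⟩ := List.getElem_of_mem hq
  obtain ⟨h3, h4⟩ := key Q[n].1 Q[n].2 hq (all n hn)
  exact ⟨h3.mono (by omega) h2, h4.mono h1 (by omega)⟩

theorem areOsculating_of_reg (hP : IsPath (a, u) (v, b) P) (hQ : IsPath (a, u') (v', b) Q)
    (h : ∀ i j, i ≤ a → j ≤ b → Reg Q i j → Reg P (i - 1) j ∧ Reg P i (j - 1)) :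
    AreOsculating P Q := by
  intro m n i j hm hn
  have hmP := List.mem_of_getElem? hm
  have hnQ := List.mem_of_getElem? hn
  have hb := hQ.mem_bounds hnQ
  simp only at hb
  have hno := ((hP.mem_iff (by omega) (by omega)).1 hmP).2
  obtain ⟨h1, h2⟩ := h i j (by omega) (by omega) (reg_of_mem hnQ)
  have hl : (i, j - 1) ∈ P :=
    (hP.mem_iff (by omega) (by omega)).2 ⟨h2, fun h => hno (h.mono le_rfl (by omega))⟩
  have hup : (i - 1, j) ∈ P :=
    (hP.mem_iff (by omega) (by omega)).2 ⟨h1, fun h => hno (h.mono (by omega) le_rfl)⟩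
  obtain ⟨hm1, hm2⟩ := List.getElem?_eq_some_iff.1 hm
  obtain ⟨hn1, hn2⟩ := List.getElem?_eq_some_iff.1 hn
  have hcm := hP.content_getElem m hm1
  rw [hm2] at hcm
  simp only at hcm
  obtain ⟨m', hm', hml⟩ := List.getElem_of_mem hl
  have hcl := hP.content_getElem m' hm'
  rw [hml] at hcl
  simp only at hcl
  refine ⟨⟨by omega, hP.getElem?_eq_some hl _ (by simp only; omega)⟩,
    hP.getElem?_eq_some hup _ (by simp only; omega), fun hn0 => ?_, fun hne => ?_⟩
  · obtain ⟨k, rfl⟩ := Nat.exists_eq_succ_of_ne_zero hn0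
    rw [Nat.succ_sub_one, List.getElem?_eq_getElem (by omega)]
    have hs := hQ.step k hn1
    rw [hn2] at hs
    simp only at hs
    rcases hs with ⟨h3, h4⟩ | ⟨h3, h4⟩
    -- If `Q` arrived from the left, `(i, j - 1)` would lie in its region, hence `(i - 1, j - 1)` in
    -- that of `P`, and `(i, j)` could not be on `P`.
    · refine absurd (h i (j - 1) (by omega) (by omega) ⟨_, List.getElem_mem (n := k) (by omega),
        by omega, by omega⟩).1 hno
    · exact congrArg some (Prod.ext (by simp only; omega) (by simp only; omega))
  · have hlt : n + 1 < Q.length := by omega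
    rw [List.getElem?_eq_getElem hlt]
    have hs := hQ.step n hlt
    rw [hn2] at hs
    simp only at hs
    rcases hs with ⟨h3, h4⟩ | ⟨h3, h4⟩
    · exact congrArg some (Prod.ext h3 h4)
    · refine absurd (h (i - 1) j (by omega) (by omega) ⟨_, List.getElem_mem hlt,
        by omega, by omega⟩).2 hno

end Region

/-! ### Height functions -/

/-- A down-closed subset of `Fin r` is an initial segment, so its cardinality determines it. -/
theorem lt_card_filter_iff {r : ℕ} {p : Fin r → Prop} [DecidablePred p]
    (hp : ∀ k k', k ≤ k' → p k' → p k) (k : Fin r) :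
    (k : ℕ) < (Finset.univ.filter p).card ↔ p k := by
  constructor
  · intro h
    by_contra hk
    have : Finset.univ.filter p ⊆ Finset.Iio k := by
      intro k' hk'
      simp only [Finset.mem_filter, Finset.mem_univ, true_and] at hk'
      rw [Finset.mem_Iio]
      by_contra hlt
      exact hk (hp _ _ (not_lt.1 hlt) hk')
    have := Finset.card_le_card this
    rw [Fin.card_Iio] at this
    omega
  · intro hk
    have : Finset.Iic k ⊆ Finset.univ.filter p := by
      intro k' hk'
      rw [Finset.mem_Iic] at hk'
      simpa using hp _ _ hk' hk
    have := Finset.card_le_card this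
    rw [Fin.card_Iic] at this
    omega

theorem card_filter_fin_lt {r : ℕ} {n : ℤ} (h0 : 0 ≤ n) (hr : n ≤ r) :
    ((Finset.univ.filter fun k : Fin r => (k : ℤ) < n).card : ℤ) = n := by
  lift n to ℕ using h0
  have := Fin.card_filter_val_lt (n := r) (m := n)
  simp only [Nat.cast_lt, this]
  omega

open Classical in
/-- The number of paths of `P` passing weakly above and to the left of `(i, j)`. -/
noncomputable def height {r : ℕ} (P : Fin r → List (ℤ × ℤ)) (i j : ℤ) : ℤ :=
  ((Finset.univ.filter fun k => Reg (P k) i j).card : ℤ)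

/-- The number of paths starting in a column `≤ j`. -/
def colCount {a b : ℕ} (B : BoundaryPair a b) (j : ℤ) : ℤ :=
  ((Finset.univ.filter fun k : Fin B.r => (B.col k : ℤ) ≤ j).card : ℤ)

/-- The number of paths ending in a row `≤ i`. -/
def rowCount {a b : ℕ} (B : BoundaryPair a b) (i : ℤ) : ℤ :=
  ((Finset.univ.filter fun k : Fin B.r => (B.row k : ℤ) ≤ i).card : ℤ)

section BoundaryPair

variable {a b : ℕ} (B : BoundaryPair a b)

theorem BoundaryPair.one_le_row (k : Fin B.r) : 1 ≤ B.row k :=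
  (Finset.mem_Icc.1 (B.α_subset (B.α.orderEmbOfFin_mem rfl k))).1

theorem BoundaryPair.one_le_col (k : Fin B.r) : 1 ≤ B.col k :=
  (Finset.mem_Icc.1 (B.β_subset (B.β.orderEmbOfFin_mem B.card_eq k))).1

theorem lt_colCount_iff (k : Fin B.r) (j : ℤ) : (k : ℤ) < colCount B j ↔ (B.col k : ℤ) ≤ j := by
  rw [colCount, Nat.cast_lt]
  refine lt_card_filter_iff (fun k k' h hk => ?_) k
  have := B.col_strictMono.monotone h
  omega

theorem lt_rowCount_iff (k : Fin B.r) (i : ℤ) : (k : ℤ) < rowCount B i ↔ (B.row k : ℤ) ≤ i := by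
  rw [rowCount, Nat.cast_lt]
  refine lt_card_filter_iff (fun k k' h hk => ?_) k
  have := B.row_strictMono.monotone h
  omega

theorem colCount_nonneg (j : ℤ) : 0 ≤ colCount B j := Nat.cast_nonneg _

theorem rowCount_nonneg (j : ℤ) : 0 ≤ rowCount B j := Nat.cast_nonneg _

theorem colCount_le (j : ℤ) : colCount B j ≤ B.r := by
  have := Finset.card_filter_le (Finset.univ : Finset (Fin B.r)) fun k => (B.col k : ℤ) ≤ j
  rw [Finset.card_univ, Fintype.card_fin] at this
  rw [colCount]
  exact_mod_cast this

theorem rowCount_le (j : ℤ) : rowCount B j ≤ B.r := by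
  have := Finset.card_filter_le (Finset.univ : Finset (Fin B.r)) fun k => (B.row k : ℤ) ≤ j
  rw [Finset.card_univ, Fintype.card_fin] at this
  rw [rowCount]
  exact_mod_cast this

end BoundaryPair

/-- Height functions of six-vertex configurations on `[a] × [b]` with boundary given by `B`. -/
structure IsHeight (a b : ℕ) (B : BoundaryPair a b) (h : ℤ → ℤ → ℤ) : Prop where
  down : ∀ i j, h (i + 1) j = h i j ∨ h (i + 1) j = h i j + 1
  right : ∀ i j, h i (j + 1) = h i j ∨ h i (j + 1) = h i j + 1
  top : ∀ i j, i ≤ 0 → h i j = 0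
  left : ∀ i j, j ≤ 0 → h i j = 0
  clamp : ∀ i j, h i j = h (min i a) (min j b)
  bottom : ∀ j, h a j = colCount B j
  side : ∀ i, h i b = rowCount B i

namespace IsHeight

variable {a b : ℕ} {B : BoundaryPair a b} {h : ℤ → ℤ → ℤ}

theorem mono_down (H : IsHeight a b B h) {i i' : ℤ} (hi : i ≤ i') (j : ℤ) : h i j ≤ h i' j :=
  (monotone_int_of_le_succ (f := fun i => h i j)
    fun i => by rcases H.down i j with h1 | h1 <;> omega) hi

theorem mono_right (H : IsHeight a b B h) (i : ℤ) {j j' : ℤ} (hj : j ≤ j') : h i j ≤ h i j' :=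
  (monotone_int_of_le_succ (f := fun j => h i j)
    fun j => by rcases H.right i j with h1 | h1 <;> omega) hj

theorem nonneg (H : IsHeight a b B h) (i j : ℤ) : 0 ≤ h i j := by
  rcases le_total i 0 with hi | hi
  · rw [H.top _ _ hi]
  · rw [← H.top 0 j le_rfl]
    exact H.mono_down hi j

theorem le_r (H : IsHeight a b B h) (i j : ℤ) : h i j ≤ B.r := by
  rw [H.clamp]
  calc h (min i a) (min j b) ≤ h a (min j b) := H.mono_down (min_le_right _ _) _
    _ ≤ B.r := by rw [H.bottom]; exact colCount_le B _

end IsHeight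

/-! ### Osculating paths and height functions -/

section OP

variable {a b : ℕ} {B : BoundaryPair a b} {P : Fin B.r → List (ℤ × ℤ)}

theorem reg_of_reg_succ (hP : P ∈ OP a b B) (k : Fin B.r) (hk : (k : ℕ) + 1 < B.r) {i j : ℤ}
    (h : Reg (P ⟨k + 1, hk⟩) i j) : Reg (P k) (i - 1) j ∧ Reg (P k) i (j - 1) := by
  refine (hP.2 k hk).reg (hP.1 k) (hP.1 _) ?_ h
  have : B.col k < B.col ⟨k + 1, hk⟩ := B.col_strictMono (Fin.lt_def.2 (Nat.lt_succ_self _))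
  omega

theorem reg_anti (hP : P ∈ OP a b B) (i j : ℤ) (k k' : Fin B.r) (hk : k ≤ k')
    (h : Reg (P k') i j) : Reg (P k) i j := by
  obtain ⟨k, hk1⟩ := k
  obtain ⟨k', hk2⟩ := k'
  obtain ⟨d, rfl⟩ := Nat.exists_eq_add_of_le (show k ≤ k' from hk)
  induction d with
  | zero => exact h
  | succ d ih =>
    refine ih (by omega) ((reg_of_reg_succ hP ⟨k + d, by omega⟩ hk2 h).1.mono (by omega) le_rfl)
      (by simp [Fin.le_def])

/-- The regions are nested, so those containing a point belong to the first `height P i j` paths.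
This is how single paths are recovered from the height. -/
theorem lt_height_iff (hP : P ∈ OP a b B) (k : Fin B.r) (i j : ℤ) :
    (k : ℤ) < height P i j ↔ Reg (P k) i j := by
  classical
  rw [height, Nat.cast_lt]
  convert lt_card_filter_iff (reg_anti hP i j) k

theorem height_nonneg (i j : ℤ) : 0 ≤ height P i j := Nat.cast_nonneg _

theorem height_le (i j : ℤ) : height P i j ≤ B.r := by
  classical
  have := Finset.card_filter_le (Finset.univ : Finset (Fin B.r)) fun k => Reg (P k) i j
  rw [Finset.card_univ, Fintype.card_fin] at this
  rw [height]
  exact_mod_cast this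

theorem height_congr {Q : Fin B.r → List (ℤ × ℤ)} {i j i' j' : ℤ}
    (h : ∀ k, Reg (P k) i j ↔ Reg (Q k) i' j') : height P i j = height Q i' j' := by
  classical
  rw [height, height]
  congr 2
  ext k
  simp only [Finset.mem_filter, Finset.mem_univ, true_and, h]

theorem isHeight_height (hP : P ∈ OP a b B) : IsHeight a b B (height P) := by
  classical
  have mono : ∀ {i j i' j' : ℤ}, i ≤ i' → j ≤ j' → height P i j ≤ height P i' j' := by
    intro i j i' j' hi hj
    rw [height, height, Nat.cast_le]
    refine Finset.card_le_card fun k hk => ?_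
    simp only [Finset.mem_filter, Finset.mem_univ, true_and] at hk ⊢
    exact hk.mono hi hj
  have succ : ∀ {i j i' j' : ℤ}, (∀ k hk, Reg (P ⟨k + 1, hk⟩) i' j' →
      Reg (P ⟨k, by omega⟩) i j) → height P i' j' ≤ height P i j + 1 := by
    intro i j i' j' hs
    by_contra hlt
    have h0 := height_nonneg (P := P) i j
    have h1 := height_le (P := P) i' j'
    obtain ⟨n, hn⟩ := Int.eq_ofNat_of_zero_le h0
    have hk : n + 1 < B.r := by omega
    have h2 := hs n hk ((lt_height_iff hP _ _ _).1 (by simp only; push_cast; omega))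
    have h3 := (lt_height_iff hP _ _ _).2 h2
    simp only at h3
    omega
  have zero : ∀ {i j : ℤ}, (∀ k, ¬Reg (P k) i j) → height P i j = 0 := by
    intro i j h
    simp [height, h]
  refine ⟨fun i j => ?_, fun i j => ?_, fun i j hi => zero fun k hk => ?_,
    fun i j hj => zero fun k hk => ?_, fun i j => ?_, fun j => ?_, fun i => ?_⟩
  · have h1 := mono (i := i) (i' := i + 1) (j := j) (j' := j) (by omega) le_rfl
    have h2 := succ (i := i) (i' := i + 1) (j := j) (j' := j) fun k hk h => by
      simpa using (reg_of_reg_succ hP ⟨k, by omega⟩ hk h).1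
    omega
  · have h1 := mono (i := i) (i' := i) (j := j) (j' := j + 1) le_rfl (by omega)
    have h2 := succ (i := i) (i' := i) (j := j) (j' := j + 1) fun k hk h => by
      simpa using (reg_of_reg_succ hP ⟨k, by omega⟩ hk h).2
    omega
  · have := ((hP.1 k).le_of_reg hk).1
    have := B.one_le_row k
    omega
  · have := ((hP.1 k).le_of_reg hk).2
    have := B.one_le_col k
    omega
  · exact height_congr fun k => (hP.1 k).reg_clamp i j
  · simp only [height, colCount, (hP.1 _).reg_bottom]
  · simp only [height, rowCount, (hP.1 _).reg_right]

theorem height_bijOn (a b : ℕ) (B : BoundaryPair a b) :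
    Set.BijOn height (OP a b B) {h | IsHeight a b B h} := by
  classical
  refine ⟨fun P hP => isHeight_height hP, fun P hP Q hQ h => ?_, fun h H => ?_⟩
  · funext k
    refine (hP.1 k).eq_of_reg_iff (hQ.1 k) fun i j _ _ => ?_
    rw [← lt_height_iff hP, ← lt_height_iff hQ, h]
  · have H : IsHeight a b B h := H
    -- The `k`-th path is the boundary of the up-set where `h` exceeds `k`.
    have ex : ∀ k : Fin B.r, ∃ P, IsPath ((a : ℤ), (B.col k : ℤ)) ((B.row k : ℤ), (b : ℤ)) P ∧
        ∀ i j, i ≤ (a : ℤ) → j ≤ (b : ℤ) → (Reg P i j ↔ (k : ℤ) < h i j) := by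
      intro k
      refine exists_isPath_reg_iff (R := fun i j => (k : ℤ) < h i j) ?_
        (by exact_mod_cast B.row_le k) (by exact_mod_cast B.col_le k) ?_ ?_
      · intro i j i' j' hk hi hj
        exact hk.trans_le ((H.mono_down hi j).trans (H.mono_right i' hj))
      · intro j _
        rw [H.bottom, lt_colCount_iff]
      · intro i _
        rw [H.side, lt_rowCount_iff]
    choose P hP hP' using ex
    have hOP : P ∈ OP a b B := by
      refine ⟨hP, fun k hk => areOsculating_of_reg (hP k) (hP _) fun i j hi hj hr => ?_⟩
      rw [hP' _ _ _ hi hj] at hr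
      rw [hP' _ _ _ (by omega) hj, hP' _ _ _ hi (by omega)]
      -- Osculation of paths `k` and `k + 1`: where `h` exceeds `k + 1`, it still exceeds `k` one
      -- unit step back.
      have h1 := H.down (i - 1) j
      have h2 := H.right i (j - 1)
      simp only [sub_add_cancel] at h1 h2
      push_cast at hr
      omega
    refine ⟨P, hOP, ?_⟩
    funext i j
    rw [(isHeight_height hOP).clamp, H.clamp, height]
    rw [← card_filter_fin_lt (H.nonneg _ _) (H.le_r (min i a) (min j b))]
    congr 2
    ext k
    simp only [Finset.mem_filter, Finset.mem_univ, true_and]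
    exact hP' k _ _ (min_le_right _ _) (min_le_right _ _)

/-- The points of `[a] × [b]` at which a height function has zero or two passing paths. -/
def heightExc (a b : ℕ) (h : ℤ → ℤ → ℤ) : Set (ℤ × ℤ) :=
  {p | (p.1 ∈ Set.Icc 1 (a : ℤ) ∧ p.2 ∈ Set.Icc 1 (b : ℤ)) ∧
    h p.1 p.2 ≠ h (p.1 - 1) (p.2 - 1) + 1}

/-- Path `k` passes through `(i, j)` iff `h (i - 1) (j - 1) ≤ k < h i j`, so no path, one path or
several pass there according to the difference of the two heights. -/
theorem vacOsc_eq (hP : P ∈ OP a b B) : vacOsc a b P = heightExc a b (height P) := by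
  have H := isHeight_height hP
  ext ⟨i, j⟩
  have hm : ∀ k, i ≤ a → j ≤ b → ((i, j) ∈ P k ↔ (k : ℤ) < height P i j ∧
      ¬(k : ℤ) < height P (i - 1) (j - 1)) := by
    intro k hi hj
    rw [lt_height_iff hP, lt_height_iff hP, (hP.1 k).mem_iff hi hj]
  have hle : height P (i - 1) (j - 1) ≤ height P i j :=
    (H.mono_down (by omega) _).trans (H.mono_right _ (by omega))
  have h0 := H.nonneg (i - 1) (j - 1)
  have h1 := H.le_r i j
  obtain ⟨n, hn⟩ := Int.eq_ofNat_of_zero_le h0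
  constructor
  · rintro (⟨hr, hv⟩ | ⟨k, k', hne, hk, hk'⟩)
    · refine ⟨hr, fun heq => ?_⟩
      simp only [Set.mem_Icc] at hr heq
      refine hv ⟨n, by omega⟩ ((hm _ (by omega) (by omega)).2 ?_)
      simp only
      omega
    · have hb := (hP.1 k).mem_bounds hk
      have h2 := B.one_le_row k
      have h3 := B.one_le_col k
      simp only at hb
      rw [hm _ (by omega) (by omega)] at hk hk'
      refine ⟨⟨⟨by simp only; omega, hb.2.1⟩, ⟨by simp only; omega, hb.2.2.2⟩⟩, fun heq => hne ?_⟩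
      simp only at heq
      exact Fin.ext (by omega)
  · rintro ⟨hr, hne⟩
    have hr' := hr
    simp only [Set.mem_Icc] at hr hne
    rcases hle.eq_or_lt with heq | hlt
    · refine Or.inl ⟨hr', fun k hk => ?_⟩
      rw [hm _ (by omega) (by omega)] at hk
      omega
    · refine Or.inr ⟨⟨n, by omega⟩, ⟨n + 1, by omega⟩, by simp, ?_, ?_⟩ <;>
      · rw [hm _ (by omega) (by omega)]
        simp only
        push_cast
        omega

end OP

/-! ### Partitions as sequences of diagonal lengths -/

/-- The condition on the lengths `u`, `v` of the diagonals `c`, `c + 1` of a partition. -/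
def Adj (c u v : ℤ) : Prop := (0 ≤ c ∧ (u = v ∨ u = v + 1)) ∨ (c < 0 ∧ (v = u ∨ v = u + 1))

/-- `D` is locally the sequence of diagonal lengths of a partition. -/
def IsPart (D : ℤ → ℤ) : Prop := ∀ c, Adj c (D c) (D (c + 1))

theorem isPart_zero : IsPart 0 := fun c => by
  rcases lt_or_ge c 0 with h | h <;> simp [Adj, h]

/-- `D` and `D'` differ by one square of content `c`. -/
structure Tog (c : ℤ) (D D' : ℤ → ℤ) : Prop where
  agree : ∀ c', c' ≠ c → D' c' = D c'
  ne : D' c ≠ D c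
  left : IsPart D
  right : IsPart D'

theorem Tog.symm {c : ℤ} {D D' : ℤ → ℤ} (h : Tog c D D') : Tog c D' D :=
  ⟨fun c' hc => (h.agree c' hc).symm, h.ne.symm, h.right, h.left⟩

/-- The neighbouring length at `c + 1` leaves only two possible values at `c`; `D c` is one, so the
changed value is the other. -/
theorem Tog.unique {c : ℤ} {D D₁ D₂ : ℤ → ℤ} (h₁ : Tog c D D₁) (h₂ : Tog c D D₂) : D₁ = D₂ := by
  funext c'
  by_cases hc : c' = c
  · subst hc
    have a0 := h₁.left c'
    have b0 := h₁.left (c' - 1)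
    have a1 := h₁.right c'
    have b1 := h₁.right (c' - 1)
    have a2 := h₂.right c'
    have b2 := h₂.right (c' - 1)
    rw [h₁.agree (c' + 1) (by omega)] at a1
    rw [h₁.agree (c' - 1) (by omega)] at b1
    rw [h₂.agree (c' + 1) (by omega)] at a2
    rw [h₂.agree (c' - 1) (by omega)] at b2
    rw [sub_add_cancel] at b0 b1 b2
    have n1 := h₁.ne
    have n2 := h₂.ne
    simp only [Adj] at a0 a1 a2 b0 b1 b2
    omega
  · rw [h₁.agree _ hc, h₂.agree _ hc]

/-- The word `s`, read from its end, lists the contents of the successive squares by which the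
partitions of an oscillating tableau ending at `D` differ. -/
def Runs : List ℤ → (ℤ → ℤ) → Prop
  | [], D => D = 0
  | c :: s, D => ∃ D', Runs s D' ∧ Tog c D' D

theorem Runs.isPart {s : List ℤ} {D : ℤ → ℤ} (h : Runs s D) : IsPart D := by
  cases s with
  | nil => exact (show D = 0 from h) ▸ isPart_zero
  | cons c s =>
    obtain ⟨D', -, h⟩ := h
    exact h.right

/-- While both neighbouring diagonals are empty, only content `0` can acquire a square. Hence
content `c` is not reached before step `|c| + 1`. -/
theorem Runs.eq_zero {s : List ℤ} {D : ℤ → ℤ} (h : Runs s D) (c : ℤ) (hc : (s.length : ℤ) ≤ |c|) :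
    D c = 0 := by
  induction s generalizing D c with
  | nil => rw [show D = 0 from h]; rfl
  | cons d s ih =>
    obtain ⟨D', h, ht⟩ := h
    simp only [List.length_cons, Nat.cast_add, Nat.cast_one] at hc
    by_cases hcd : c = d
    · subst hcd
      have a1 := ht.right c
      have b1 := ht.right (c - 1)
      rw [sub_add_cancel] at b1
      have hs : (0 : ℤ) ≤ s.length := Nat.cast_nonneg _
      rcases abs_cases c with ⟨h1, h2⟩ | ⟨h1, h2⟩
      · rw [ht.agree (c - 1) (by omega), ih h (c - 1) (by rw [abs_of_nonneg (by omega)]; omega)] at b1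
        rw [ht.agree (c + 1) (by omega), ih h (c + 1) (by rw [abs_of_nonneg (by omega)]; omega)] at a1
        simp only [Adj] at a1 b1
        omega
      · rw [ht.agree (c - 1) (by omega), ih h (c - 1) (by rw [abs_of_nonpos (by omega)]; omega)] at b1
        rw [ht.agree (c + 1) (by omega), ih h (c + 1) (by rw [abs_of_nonpos (by omega)]; omega)] at a1
        simp only [Adj] at a1 b1
        omega
    · rw [ht.agree _ hcd]
      exact ih h c (by omega)

theorem Runs.abs_le {s : List ℤ} {D : ℤ → ℤ} (h : Runs s D) (c : ℤ) (hc : c ∈ s) :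
    |c| ≤ s.length := by
  induction s generalizing D with
  | nil => simp at hc
  | cons d s ih =>
    have h' := h
    obtain ⟨D', h, ht⟩ := h
    simp only [List.length_cons, Nat.cast_add, Nat.cast_one]
    rcases List.mem_cons.1 hc with rfl | hc
    · by_contra hlt
      refine ht.ne ?_
      rw [h'.eq_zero c (by simp only [List.length_cons]; push_cast; omega),
        h.eq_zero c (by omega)]
    · have := ih h hc
      omega

/-- The words of length `l` which run to `D`. -/
def words (D : ℤ → ℤ) (l : ℕ) : Set (List ℤ) := {s | s.length = l ∧ Runs s D}

theorem words_finite (D : ℤ → ℤ) (l : ℕ) : (words D l).Finite := by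
  refine ((List.finite_length_eq (Set.Icc (-(l : ℤ)) l) l).image
    (List.map Subtype.val)).subset ?_
  rintro s ⟨hl, hs⟩
  refine ⟨s.attach.map fun c => ⟨c.1, ?_⟩, ?_, ?_⟩
  · have := hs.abs_le _ c.2
    rw [hl] at this
    exact abs_le.1 this
  · simpa using hl
  · simp [Function.comp_def]

theorem words_zero_zero : words 0 0 = {[]} := by
  ext s
  simp only [words, Set.mem_ofPred_eq, List.length_eq_zero_iff, Set.mem_singleton_iff]
  constructor
  · exact fun h => h.1
  · rintro rfl
    exact ⟨rfl, rfl⟩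

theorem cons_mem_words_iff {c : ℤ} {D D' : ℤ → ℤ} (h : Tog c D' D) (l : ℕ) (s : List ℤ) :
    c :: s ∈ words D (l + 1) ↔ s ∈ words D' l := by
  simp only [words, Set.mem_ofPred_eq, List.length_cons, Nat.add_right_cancel_iff]
  refine and_congr_right fun _ => ⟨?_, fun hs => ⟨D', hs, h⟩⟩
  rintro ⟨D'', hs, h'⟩
  rwa [h.symm.unique h'.symm]

/-! ### Occurrences of a word as a sublist -/

/-- The number of occurrences of `s` as a sublist of `L`. -/
def emb : List ℤ → List ℤ → ℕ
  | [], _ => 1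
  | _ :: _, [] => 0
  | c :: s, d :: L => emb (c :: s) L + if c = d then emb s L else 0

theorem emb_nil (L : List ℤ) : emb [] L = 1 := by
  cases L <;> rfl

/-- An occurrence either skips the initial `c` of the list or matches it with the head of the word.
The auxiliary `f` extends the second count by zero to words with another head. -/
theorem finsum_words_emb_cons (D : ℤ → ℤ) (l : ℕ) (c : ℤ) (L : List ℤ) :
    ∑ᶠ s ∈ words D (l + 1), emb s (c :: L) =
      ∑ᶠ s ∈ words D (l + 1), emb s L + ∑ᶠ s ∈ {s | c :: s ∈ words D (l + 1)}, emb s L := by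
  let f : List ℤ → ℕ := fun s => if s.head? = some c then emb s.tail L else 0
  have h1 : ∑ᶠ s ∈ words D (l + 1), emb s (c :: L) =
      ∑ᶠ s ∈ words D (l + 1), (emb s L + f s) := by
    refine finsum_mem_congr rfl fun s hs => ?_
    cases s with
    | nil => simp [words] at hs
    | cons d s => simp [emb, f]
  rw [h1, finsum_mem_add_distrib (words_finite _ _)]
  congr 1
  have h2 : ∑ᶠ s ∈ List.cons c '' {s | c :: s ∈ words D (l + 1)}, f s =
      ∑ᶠ s ∈ {s | c :: s ∈ words D (l + 1)}, emb s L := by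
    rw [finsum_mem_image (List.cons_injective.injOn)]
    simp [f]
  rw [← h2]
  refine finsum_mem_inter_support_eq' f _ _ fun s hs => ?_
  cases s with
  | nil => simp [f] at hs
  | cons d s =>
    have : d = c := by
      by_contra hd
      simp [f, hd] at hs
    subst this
    simp

/-! ### Lazy walks -/

/-- The state of a lazy walk after the positions in `Ps` (most recent first), `x p` being the
length of the diagonal `p.2` right after position `p`. -/
def walkState : List (ℕ × ℤ) → (ℕ × ℤ → ℤ) → ℤ → ℤ
  | [], _ => 0
  | p :: Ps, x => Function.update (walkState Ps x) p.2 (x p)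

/-- All states of the lazy walk are partitions. -/
def WalkValid : List (ℕ × ℤ) → (ℕ × ℤ → ℤ) → Prop
  | [], _ => True
  | p :: Ps, x => WalkValid Ps x ∧ IsPart (walkState (p :: Ps) x)

/-- The number of positions at which the state changes. -/
def walkChanges : List (ℕ × ℤ) → (ℕ × ℤ → ℤ) → ℕ
  | [], _ => 0
  | p :: Ps, x => walkChanges Ps x + if x p = walkState Ps x p.2 then 0 else 1

section Congr

variable {Ps : List (ℕ × ℤ)} {x y : ℕ × ℤ → ℤ}

theorem walkState_congr (h : ∀ p ∈ Ps, x p = y p) : walkState Ps x = walkState Ps y := by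
  induction Ps with
  | nil => rfl
  | cons p Ps ih =>
    rw [List.forall_mem_cons] at h
    rw [walkState, walkState, ih h.2, h.1]

theorem walkValid_congr (h : ∀ p ∈ Ps, x p = y p) : WalkValid Ps x ↔ WalkValid Ps y := by
  induction Ps with
  | nil => rfl
  | cons p Ps ih =>
    rw [WalkValid, WalkValid, walkState_congr h, ih (List.forall_mem_cons.1 h).2]

theorem walkChanges_congr (h : ∀ p ∈ Ps, x p = y p) : walkChanges Ps x = walkChanges Ps y := by
  induction Ps with
  | nil => rfl
  | cons p Ps ih =>
    rw [List.forall_mem_cons] at h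
    rw [walkChanges, walkChanges, ih h.2, h.1, walkState_congr h.2]

theorem WalkValid.isPart (h : WalkValid Ps x) : IsPart (walkState Ps x) := by
  cases Ps with
  | nil => exact isPart_zero
  | cons p Ps => exact h.2

end Congr

/-- The lazy walks along `Ps` from the empty partition to `D` with `l` changes. -/
def walks (Ps : List (ℕ × ℤ)) (D : ℤ → ℤ) (l : ℕ) : Set (ℕ × ℤ → ℤ) :=
  {x | (∀ p ∉ Ps, x p = 0) ∧ WalkValid Ps x ∧ walkState Ps x = D ∧ walkChanges Ps x = l}

/-- The most recent position either leaves the state alone or toggles content `p.2`. The value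
recorded there is `D p.2` in both cases, so resetting it to the default `0` loses nothing. -/
theorem walks_cons {p : ℕ × ℤ} {Ps : List (ℕ × ℤ)} (hp : p ∉ Ps) (D : ℤ → ℤ) (l : ℕ) :
    walks (p :: Ps) D l = (fun y => Function.update y p (D p.2)) ''
      (walks Ps D l ∪ {y | ∃ D' l', Tog p.2 D' D ∧ l = l' + 1 ∧ y ∈ walks Ps D' l'}) := by
  have agree : ∀ (y : ℕ × ℤ → ℤ) v, ∀ q ∈ Ps, Function.update y p v q = y q := fun y v q hq =>
    Function.update_of_ne (by rintro rfl; exact hp hq) _ _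
  ext x
  constructor
  · rintro ⟨h1, ⟨h2, h3⟩, h4, h5⟩
    have hD : D p.2 = x p := by
      rw [← h4, walkState, Function.update_self]
    refine ⟨Function.update x p 0, ?_, ?_⟩
    · have hsupp : ∀ q ∉ Ps, Function.update x p 0 q = 0 := by
        intro q hq
        by_cases hqp : q = p
        · rw [hqp, Function.update_self]
        · rw [Function.update_of_ne hqp]
          exact h1 q (by simp [hq, hqp])
      have hmem : ∀ D' l', walkState Ps x = D' → walkChanges Ps x = l' →
          Function.update x p 0 ∈ walks Ps D' l' := fun D' l' hs hc =>
        ⟨hsupp, (walkValid_congr (agree x 0)).2 h2, (walkState_congr (agree x 0)).trans hs,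
          (walkChanges_congr (agree x 0)).trans hc⟩
      by_cases hx : x p = walkState Ps x p.2
      · left
        refine hmem _ _ ?_ ?_
        · rw [← h4, walkState, hx, Function.update_eq_self]
        · rw [walkChanges, if_pos hx] at h5
          exact h5
      · right
        rw [walkChanges, if_neg hx] at h5
        refine ⟨walkState Ps x, walkChanges Ps x, ⟨fun c' hc => ?_, ?_, h2.isPart, h4 ▸ h3⟩,
          h5.symm, hmem _ _ rfl rfl⟩
        · rw [← h4, walkState, Function.update_of_ne hc]
        · rwa [hD]
    · simp [hD]
  · have main : ∀ y D' l', y ∈ walks Ps D' l' → (∀ c', c' ≠ p.2 → D c' = D' c') → IsPart D →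
        (l' + if D p.2 = D' p.2 then 0 else 1) = l →
        Function.update y p (D p.2) ∈ walks (p :: Ps) D l := by
      rintro y D' l' ⟨h1, h2, h3, h4⟩ hag hD hl
      have hst : walkState (p :: Ps) (Function.update y p (D p.2)) = D := by
        rw [walkState, walkState_congr (agree y _), h3, Function.update_self]
        funext c'
        by_cases hc : c' = p.2
        · rw [hc, Function.update_self]
        · rw [Function.update_of_ne hc, hag _ hc]
      refine ⟨fun q hq => ?_, ⟨(walkValid_congr (agree y _)).2 h2, by rwa [hst]⟩, hst, ?_⟩
      · rw [List.mem_cons, not_or] at hq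
        rw [Function.update_of_ne hq.1]
        exact h1 q hq.2
      · rw [walkChanges, walkChanges_congr (agree y _), walkState_congr (agree y _), h3, h4,
          Function.update_self, hl]
    rintro ⟨y, hy | ⟨D', l', ht, rfl, hy⟩, rfl⟩
    · refine main y D l hy (fun _ _ => rfl) ?_ (by simp)
      rw [← hy.2.2.1]
      exact hy.2.1.isPart
    · exact main y D' l' hy ht.agree ht.right (by rw [if_neg ht.ne])

/-- Both sides obey the same recursion: walks split by whether the most recent position changes the
state, occurrences by whether they use the first entry of the list. By `Tog.unique` at most one
earlier state can be changed into `D` at that position. -/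
theorem ncard_walks (Ps : List (ℕ × ℤ)) (hn : Ps.Nodup) (D : ℤ → ℤ) (l : ℕ) :
    (walks Ps D l).Finite ∧
      (walks Ps D l).ncard = ∑ᶠ s ∈ words D l, emb s (Ps.map Prod.snd) := by
  induction Ps generalizing D l with
  | nil =>
    by_cases h : D = 0 ∧ l = 0
    · obtain ⟨rfl, rfl⟩ := h
      have : walks [] 0 0 = {0} := by
        ext x
        simp only [walks, Set.mem_ofPred_eq, WalkValid, walkState, walkChanges, and_true,
          Set.mem_singleton_iff, List.not_mem_nil, not_false_eq_true, forall_const]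
        exact ⟨fun h => funext h, fun h p => congrFun h p⟩
      rw [this, words_zero_zero]
      simp [emb_nil]
    · have : walks [] D l = ∅ := by
        ext x
        simp only [walks, Set.mem_ofPred_eq, walkState, walkChanges, Set.mem_empty_iff_false,
          iff_false]
        rintro ⟨-, -, h1, h2⟩
        exact h ⟨h1.symm, h2.symm⟩
      rw [this]
      refine ⟨Set.finite_empty, ?_⟩
      rw [Set.ncard_empty]
      symm
      refine finsum_mem_eq_zero_of_forall_eq_zero fun s hs => ?_
      cases s with
      | nil => exact absurd ⟨hs.2, hs.1.symm⟩ h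
      | cons c s => rfl
  | cons p Ps ih =>
    rw [List.nodup_cons] at hn
    have inj : ∀ A : Set (ℕ × ℤ → ℤ), (∀ y ∈ A, y p = 0) →
        Set.InjOn (fun y => Function.update y p (D p.2)) A := by
      intro A hA y hy z hz hyz
      funext q
      by_cases hq : q = p
      · rw [hq, hA y hy, hA z hz]
      · have := congrFun hyz q
        simpa only [Function.update_of_ne hq] using this
    rw [walks_cons hn.1]
    set A := {y | ∃ D' l', Tog p.2 D' D ∧ l = l' + 1 ∧ y ∈ walks Ps D' l'} with hA
    have hdisj : Disjoint (walks Ps D l) A := by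
      rw [Set.disjoint_left]
      rintro y hy ⟨D', l', ht, -, hy'⟩
      exact ht.ne (by rw [← hy.2.2.1, ← hy'.2.2.1])
    have hzero : ∀ y ∈ walks Ps D l ∪ A, y p = 0 := by
      rintro y (hy | ⟨D', l', -, -, hy⟩) <;> exact hy.1 p hn.1
    have key : A.Finite ∧ ∑ᶠ s ∈ words D l, emb s (p.2 :: Ps.map Prod.snd) =
        ∑ᶠ s ∈ words D l, emb s (Ps.map Prod.snd) + A.ncard := by
      cases l with
      | zero =>
        have : A = ∅ := by
          ext y
          simp [hA]
        rw [this]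
        refine ⟨Set.finite_empty, ?_⟩
        rw [Set.ncard_empty, add_zero]
        refine finsum_mem_congr rfl fun s hs => ?_
        rw [List.length_eq_zero_iff.1 hs.1, emb_nil, emb_nil]
      | succ l =>
        rw [finsum_words_emb_cons]
        by_cases ht : ∃ D', Tog p.2 D' D
        · obtain ⟨D', ht⟩ := ht
          have : A = walks Ps D' l := by
            ext y
            constructor
            · rintro ⟨D'', l', ht', hl, hy⟩
              obtain rfl : l = l' := by omega
              rwa [ht.symm.unique ht'.symm]
            · exact fun hy => ⟨D', l, ht, rfl, hy⟩
          rw [this]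
          refine ⟨(ih hn.2 D' l).1, ?_⟩
          rw [(ih hn.2 D' l).2]
          congr 1
          refine finsum_mem_congr ?_ fun _ _ => rfl
          ext s
          exact cons_mem_words_iff ht l s
        · have : A = ∅ := by
            ext y
            simp only [hA, Set.mem_ofPred_eq, Set.mem_empty_iff_false, iff_false]
            rintro ⟨D', l', ht', -⟩
            exact ht ⟨D', ht'⟩
          rw [this]
          refine ⟨Set.finite_empty, ?_⟩
          rw [Set.ncard_empty]
          congr 1
          refine (finsum_mem_congr ?_ fun _ _ => rfl).trans finsum_mem_empty
          ext s
          simp only [Set.mem_ofPred_eq, Set.mem_empty_iff_false, iff_false]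
          rintro ⟨-, D', -, ht'⟩
          exact ht ⟨D', ht'⟩
    refine ⟨((ih hn.2 D l).1.union key.1).image _, ?_⟩
    rw [Set.InjOn.ncard_image (inj _ hzero), Set.ncard_union_eq hdisj (ih hn.2 D l).1 key.1,
      (ih hn.2 D l).2, List.map_cons, key.2]

/-! ### Occurrences of a word in repeated blocks -/

open Classical in
/-- The number of ascents of a word which is read from its end. -/
noncomputable def ascW (prec : ℤ → ℤ → Prop) : List ℤ → ℕ
  | [] => 0
  | [_] => 0
  | c :: d :: s => ascW prec (d :: s) + if prec d c then 1 else 0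

theorem ascW_le (prec : ℤ → ℤ → Prop) (c : ℤ) (s : List ℤ) : ascW prec (c :: s) ≤ s.length := by
  induction s generalizing c with
  | nil => simp [ascW]
  | cons d s ih =>
    have := ih d
    rw [ascW, List.length_cons]
    split_ifs <;> omega

theorem emb_append_of_notMem {c : ℤ} {s L₁ L₂ : List ℤ} (h : c ∉ L₁) :
    emb (c :: s) (L₁ ++ L₂) = emb (c :: s) L₂ := by
  induction L₁ with
  | nil => rfl
  | cons d L₁ ih =>
    rw [List.mem_cons, not_or] at h
    rw [List.cons_append, emb, ih h.2, if_neg h.1, add_zero]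

/-- The positions `(t, c)` with `1 ≤ t ≤ m` and `c ∈ bl`, in reverse lexicographic order. -/
def positions (bl : List ℤ) : ℕ → List (ℕ × ℤ)
  | 0 => []
  | t + 1 => bl.map (fun c => (t + 1, c)) ++ positions bl t

theorem mem_positions (bl : List ℤ) (m t : ℕ) (c : ℤ) :
    (t, c) ∈ positions bl m ↔ 1 ≤ t ∧ t ≤ m ∧ c ∈ bl := by
  induction m with
  | zero => simp only [positions, List.not_mem_nil, false_iff]; omega
  | succ m ih =>
    simp only [positions, List.mem_append, List.mem_map, Prod.mk.injEq, ih]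
    constructor
    · rintro (⟨c', h1, h2, rfl⟩ | ⟨h1, h2, h3⟩)
      · exact ⟨by omega, by omega, h1⟩
      · exact ⟨h1, by omega, h3⟩
    · rintro ⟨h1, h2, h3⟩
      by_cases ht : t = m + 1
      · exact Or.inl ⟨c, h3, ht.symm, rfl⟩
      · exact Or.inr ⟨h1, by omega, h3⟩

theorem nodup_positions {bl : List ℤ} (h : bl.Nodup) (m : ℕ) : (positions bl m).Nodup := by
  induction m with
  | zero => exact List.nodup_nil
  | succ m ih =>
    refine List.Nodup.append (h.map fun c d hcd => (Prod.mk.inj hcd).2) ih ?_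
    rintro ⟨t, c⟩ h1 h2
    rw [mem_positions] at h2
    simp only [List.mem_map, Prod.mk.injEq] at h1
    obtain ⟨_, _, h1, _⟩ := h1
    omega

theorem map_snd_positions_succ (bl : List ℤ) (m : ℕ) :
    (positions bl (m + 1)).map Prod.snd = bl ++ (positions bl m).map Prod.snd := by
  simp [positions, Function.comp_def]

section Block

variable {prec : ℤ → ℤ → Prop} {bl : List ℤ}

/-- Built by inserting one element at a time. The list is decreasing for `prec` because positions
are listed with the most recent first. -/
theorem exists_block (prec : ℤ → ℤ → Prop) [IsStrictTotalOrder ℤ prec] (S : Finset ℤ) :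
    ∃ bl : List ℤ, (∀ c, c ∈ bl ↔ c ∈ S) ∧ bl.Pairwise fun c d => prec d c := by
  induction S using Finset.induction_on with
  | empty => exact ⟨[], by simp⟩
  | insert a S ha ih =>
    classical
    obtain ⟨bl, h1, h2⟩ := ih
    refine ⟨bl.filter (fun c => prec a c) ++ a :: bl.filter (fun c => prec c a), ?_, ?_⟩
    · intro c
      simp only [List.mem_append, List.mem_filter, List.mem_cons, decide_eq_true_eq, h1,
        Finset.mem_insert]
      have := trichotomous_of prec a c
      grind
    · rw [List.pairwise_append, List.pairwise_cons]
      refine ⟨h2.filter _, ⟨fun c hc => ?_, h2.filter _⟩, fun c hc d hd => ?_⟩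
      · simpa using (List.mem_filter.1 hc).2
      · have h3 : prec a c := by simpa using (List.mem_filter.1 hc).2
        rcases List.mem_cons.1 hd with rfl | hd
        · exact h3
        · have h4 : prec d a := by simpa using (List.mem_filter.1 hd).2
          exact trans_of prec h4 h3

theorem nodup_of_pairwise_prec [IsStrictTotalOrder ℤ prec]
    (h : bl.Pairwise fun c d => prec d c) : bl.Nodup :=
  List.Pairwise.imp (S := (· ≠ ·))
    (fun {c d} hcd (heq : c = d) => irrefl_of prec d (by rwa [heq] at hcd)) h

/-- Pascal's rule in `m`. An occurrence of `c :: s` either avoids the first block or uses its `c`,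
leaving for `s` the rest `bl₂` of that block and `m` further blocks. If the next letter `d`
satisfies `prec d c`, it does not occur up to `c`, so `s` has all the freedom of `m + 1` blocks;
otherwise `d ∉ bl₂` and `s` is confined to `m` blocks. Each ascent thus acts as one extra block. -/
theorem emb_positions [IsStrictTotalOrder ℤ prec] (hbl : bl.Pairwise fun c d => prec d c)
    (s : List ℤ) (hs : ∀ c ∈ s, c ∈ bl) (m : ℕ) :
    emb s ((positions bl m).map Prod.snd) = Nat.choose (m + ascW prec s) s.length := by
  have hirr : ∀ c, ¬prec c c := irrefl_of prec
  induction s generalizing m with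
  | nil => simp [emb_nil]
  | cons c s ih =>
    rw [List.forall_mem_cons] at hs
    have hrec : ∀ m, emb (c :: s) ((positions bl (m + 1)).map Prod.snd) =
        emb (c :: s) ((positions bl m).map Prod.snd) + Nat.choose (m + ascW prec (c :: s))
          s.length := by
      intro m
      obtain ⟨bl₁, bl₂, hb⟩ := List.append_of_mem hs.1
      have hb₁ : ∀ R, bl ++ R = bl₁ ++ c :: (bl₂ ++ R) := fun R => by simp [hb]
      have hb₂ : ∀ R, bl ++ R = (bl₁ ++ [c]) ++ (bl₂ ++ R) := fun R => by simp [hb]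
      have hbl' := hbl
      rw [hb, List.pairwise_append, List.pairwise_cons] at hbl'
      obtain ⟨-, ⟨h2, -⟩, h1⟩ := hbl'
      have hc₁ : c ∉ bl₁ := fun h => hirr c (h1 c h c List.mem_cons_self)
      have hc₂ : c ∉ bl₂ := fun h => hirr c (h2 c h)
      rw [map_snd_positions_succ]
      rw [hb₁, emb_append_of_notMem hc₁, emb, emb_append_of_notMem hc₂, if_pos rfl]
      congr 1
      cases s with
      | nil => simp [emb_nil]
      | cons d s =>
        have hd := hs.2 d List.mem_cons_self
        rw [ascW]
        by_cases hdc : prec d c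
        · have hd₁ : d ∉ bl₁ ++ [c] := by
            intro h
            rcases List.mem_append.1 h with h | h
            · exact hirr c (trans_of prec (h1 d h c List.mem_cons_self) hdc)
            · rw [List.mem_singleton] at h
              exact hirr c (h ▸ hdc)
          have h3 := ih hs.2 (m + 1)
          rw [map_snd_positions_succ, hb₂, emb_append_of_notMem hd₁] at h3
          rw [h3, if_pos hdc]
          congr 1
          omega
        · rw [emb_append_of_notMem (fun h => hdc (h2 d h)), ih hs.2 m, if_neg hdc, add_zero]
    induction m with
    | zero =>
      -- A nonempty word has fewer ascents than letters.
      rw [Nat.choose_eq_zero_of_lt]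
      · rfl
      · have := ascW_le prec c s
        rw [List.length_cons]
        omega
    | succ m ihm =>
      rw [hrec, ihm, List.length_cons, show m + 1 + ascW prec (c :: s) =
        (m + ascW prec (c :: s)) + 1 by omega, Nat.choose_succ_succ', add_comm]

end Block

/-! ### Lazy walks through repeated blocks -/

section BlockWalk

variable {prec : ℤ → ℤ → Prop} {bl : List ℤ} {x : ℕ × ℤ → ℤ}

theorem walkState_map_append (bs : List ℤ) (t : ℕ) (Ps : List (ℕ × ℤ)) (x : ℕ × ℤ → ℤ) (c : ℤ) :
    walkState (bs.map (fun c => (t, c)) ++ Ps) x c =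
      if c ∈ bs then x (t, c) else walkState Ps x c := by
  induction bs with
  | nil => simp
  | cons d bs ih =>
    rw [List.map_cons, List.cons_append, walkState]
    by_cases hc : c = d
    · subst hc
      simp
    · rw [Function.update_of_ne hc, ih]
      simp [hc]

theorem walkState_positions (h0 : ∀ c, x (0, c) = 0) (hbl : ∀ t, ∀ c ∉ bl, x (t, c) = 0) (m : ℕ) :
    walkState (positions bl m) x = fun c => x (m, c) := by
  induction m with
  | zero => funext c; rw [h0]; rfl
  | succ m ih =>
    funext c
    rw [positions, walkState_map_append, ih]
    split_ifs with h
    · rfl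
    · simp only [hbl _ _ h]

-- Since `bl` is decreasing, the suffix starting at `c` consists of the contents up to `c` in the
-- order: these are already updated to row `m + 1`, the others still show row `m`. Contents outside
-- `bl` are zero in both rows.
open Classical in
theorem walkState_suffix (h0 : ∀ c, x (0, c) = 0) (hx : ∀ t, ∀ c ∉ bl, x (t, c) = 0)
    [IsStrictTotalOrder ℤ prec] {bs bs' : List ℤ} {c : ℤ}
    (hbl : bl.Pairwise fun c d => prec d c) (hbs : bl = bs' ++ c :: bs) (m : ℕ) :
    walkState ((c :: bs).map (fun c => (m + 1, c)) ++ positions bl m) x =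
      fun c' => if c' = c ∨ prec c' c then x (m + 1, c') else x (m, c') := by
  funext c'
  rw [walkState_map_append, walkState_positions h0 hx]
  have hbl' := hbl
  rw [hbs, List.pairwise_append, List.pairwise_cons] at hbl'
  obtain ⟨-, ⟨h2, -⟩, h1⟩ := hbl'
  by_cases hc : c' ∈ c :: bs
  · rw [if_pos hc, if_pos]
    rcases List.mem_cons.1 hc with h | h
    · exact Or.inl h
    · exact Or.inr (h2 _ h)
  · rw [if_neg hc]
    split_ifs with h
    · have : c' ∉ bl := by
        rw [hbs, List.mem_append, not_or]
        refine ⟨fun h' => ?_, hc⟩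
        rcases h with rfl | h
        · exact hc List.mem_cons_self
        · exact irrefl_of prec c (trans_of prec (h1 _ h' _ List.mem_cons_self) h)
      simp only [hx _ _ this]
    · rfl

open Classical in
theorem walkValid_succ (h0 : ∀ c, x (0, c) = 0) (hx : ∀ t, ∀ c ∉ bl, x (t, c) = 0)
    [IsStrictTotalOrder ℤ prec] (hbl : bl.Pairwise fun c d => prec d c) (m : ℕ) :
    WalkValid (positions bl (m + 1)) x ↔ WalkValid (positions bl m) x ∧ ∀ c ∈ bl,
      IsPart fun c' => if c' = c ∨ prec c' c then x (m + 1, c') else x (m, c') := by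
  have key : ∀ bs bs', bl = bs' ++ bs →
      (WalkValid (bs.map (fun c => (m + 1, c)) ++ positions bl m) x ↔
        WalkValid (positions bl m) x ∧ ∀ c ∈ bs,
          IsPart fun c' => if c' = c ∨ prec c' c then x (m + 1, c') else x (m, c')) := by
    intro bs
    induction bs with
    | nil => intro _ _; simp
    | cons c bs ih =>
      intro bs' hb
      have h1 := walkState_suffix h0 hx hbl hb m
      rw [List.map_cons, List.cons_append] at h1 ⊢
      rw [WalkValid, ih (bs' ++ [c]) (by simpa using hb), h1, List.forall_mem_cons]
      tauto
  exact key bl [] rfl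

theorem walkChanges_positions (h0 : ∀ c, x (0, c) = 0) (hx : ∀ t, ∀ c ∉ bl, x (t, c) = 0)
    (hbl : bl.Nodup) (m : ℕ) :
    walkChanges (positions bl m) x =
      ((positions bl m).filter fun p => x p ≠ x (p.1 - 1, p.2)).length := by
  induction m with
  | zero => rfl
  | succ m ih =>
    have key : ∀ bs : List ℤ, bs.Nodup →
        walkChanges (bs.map (fun c => (m + 1, c)) ++ positions bl m) x =
        ((bs.map (fun c => (m + 1, c)) ++ positions bl m).filter
          fun p => x p ≠ x (p.1 - 1, p.2)).length := by
      intro bs hbs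
      induction bs with
      | nil => exact ih
      | cons c bs ihb =>
        rw [List.nodup_cons] at hbs
        rw [List.map_cons, List.cons_append, walkChanges, ihb hbs.2, walkState_map_append,
          if_neg hbs.1, walkState_positions h0 hx, List.filter_cons]
        by_cases h : x (m + 1, c) = x (m, c) <;> simp [h]
    exact key bl hbl

/-- Arrays `x (t, c)` of diagonal lengths, `t` indexing the hooks and `c` the diagonals. -/
structure IsArray (S : Finset ℤ) (m : ℕ) (q : ℤ) (x : ℕ × ℤ → ℤ) : Prop where
  zero : ∀ c, x (0, c) = 0
  beyond : ∀ t c, m < t → x (t, c) = 0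
  outside : ∀ t, ∀ c ∉ S, x (t, c) = 0
  part : ∀ t ≤ m, IsPart fun c => x (t, c)
  left : ∀ t < m, ∀ c < q, Adj c (x (t + 1, c)) (x (t, c + 1))
  right : ∀ t < m, ∀ c ≥ q, Adj c (x (t, c)) (x (t + 1, c + 1))

/-- Being a partition only involves adjacent contents. Within a block a pair `c`, `c + 1` is seen
both old, both new, or mixed, and the order decides which mixed pair occurs: below `q` the content
`c` is updated first, from `q` on `c + 1` is. No comparison between contents on opposite sides of
`q` matters. -/
theorem walkValid_positions_iff {q : ℤ} (hprec : IsQOrder q prec)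
    (h0 : ∀ c, x (0, c) = 0) (hx : ∀ t, ∀ c ∉ bl, x (t, c) = 0)
    (hbl : bl.Pairwise fun c d => prec d c) (m : ℕ) :
    WalkValid (positions bl m) x ↔ (∀ t ≤ m, IsPart fun c => x (t, c)) ∧
      (∀ t < m, ∀ c < q, Adj c (x (t + 1, c)) (x (t, c + 1))) ∧
      (∀ t < m, ∀ c ≥ q, Adj c (x (t, c)) (x (t + 1, c + 1))) := by
  classical
  have := hprec.isStrictTotalOrder
  have hlow : ∀ c < q, prec c (c + 1) := fun c hc =>
    hprec.of_lt_of_le c (c + 1) (by omega) (by omega)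
  have hhigh : ∀ c ≥ q, prec (c + 1) c := fun c hc =>
    hprec.of_gt_of_ge (c + 1) c (by omega) (by omega)
  have hno : ∀ c d, prec c d → ¬(d = c ∨ prec d c) := by
    rintro c d h (rfl | h')
    · exact irrefl_of prec _ h
    · exact irrefl_of prec _ (trans_of prec h h')
  induction m with
  | zero =>
    simp only [positions, WalkValid, true_iff, Nat.le_zero, forall_eq, Nat.not_lt_zero,
      false_implies, implies_true, and_true, h0]
    exact isPart_zero
  | succ m ih =>
    constructor
    · intro h
      have hpart := h.isPart
      rw [walkState_positions h0 hx] at hpart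
      obtain ⟨h, h4⟩ := (walkValid_succ h0 hx hbl m).1 h
      obtain ⟨h1, h2, h3⟩ := ih.1 h
      refine ⟨fun t ht => ?_, fun t ht c hc => ?_, fun t ht c hc => ?_⟩
      · rcases ht.lt_or_eq with h | rfl
        · exact h1 t (by omega)
        · exact hpart
      · rcases (Nat.lt_succ_iff.1 ht).lt_or_eq with h | rfl
        · exact h2 t h c hc
        · by_cases hcb : c ∈ bl
          -- Look at the state just after the update of `c`, when `c + 1` is still old.
          · have h5 := h4 c hcb c
            simp only at h5
            rwa [if_pos (Or.inl trivial), if_neg (hno _ _ (hlow c hc))] at h5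
          · rw [hx _ _ hcb, ← hx t _ hcb]
            exact h1 t le_rfl c
      · rcases (Nat.lt_succ_iff.1 ht).lt_or_eq with h | rfl
        · exact h3 t h c hc
        · by_cases hcb : c + 1 ∈ bl
          · have h5 := h4 (c + 1) hcb c
            simp only at h5
            rwa [if_pos (Or.inl trivial), if_neg (hno _ _ (hhigh c hc))] at h5
          · rw [hx _ _ hcb, ← hx t _ hcb]
            exact h1 t le_rfl c
    · rintro ⟨h1, h2, h3⟩
      refine (walkValid_succ h0 hx hbl m).2 ⟨ih.2 ⟨fun t ht => h1 t (by omega),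
        fun t ht => h2 t (by omega), fun t ht => h3 t (by omega)⟩, fun c _ c' => ?_⟩
      have hle : ∀ u v, prec u v → (v = c ∨ prec v c) → (u = c ∨ prec u c) := by
        rintro u v huv (rfl | hv)
        · exact Or.inr huv
        · exact Or.inr (trans_of prec huv hv)
      rcases lt_or_ge c' q with hc | hc
      · by_cases hu : c' + 1 = c ∨ prec (c' + 1) c
        · simp only [if_pos hu, if_pos (hle _ _ (hlow c' hc) hu)]
          exact h1 _ le_rfl c'
        · simp only [if_neg hu]
          split_ifs
          · exact h2 m (by omega) c' hc
          · exact h1 m (by omega) c'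
      · by_cases hu : c' = c ∨ prec c' c
        · simp only [if_pos hu, if_pos (hle _ _ (hhigh c' hc) hu)]
          exact h1 _ le_rfl c'
        · simp only [if_neg hu]
          split_ifs
          · exact h3 m (by omega) c' hc
          · exact h1 m (by omega) c'

/-- The positions at which an array changes. -/
def arrayChanges (x : ℕ × ℤ → ℤ) : Set (ℕ × ℤ) := {p | 1 ≤ p.1 ∧ x p ≠ x (p.1 - 1, p.2)}

theorem walks_positions {q : ℤ} (hprec : IsQOrder q prec) {S : Finset ℤ}
    (hS : ∀ c, c ∈ bl ↔ c ∈ S) (hbl : bl.Pairwise fun c d => prec d c) (m : ℕ) (D : ℤ → ℤ)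
    (l : ℕ) : walks (positions bl m) D l =
      {x | IsArray S m q x ∧ (∀ c, x (m, c) = D c) ∧
        {p | p ∈ arrayChanges x ∧ p.1 ≤ m}.encard = l} := by
  have := hprec.isStrictTotalOrder
  have hnd : bl.Nodup := nodup_of_pairwise_prec hbl
  have hsupp : ∀ x : ℕ × ℤ → ℤ, (∀ p ∉ positions bl m, x p = 0) ↔
      (∀ c, x (0, c) = 0) ∧ (∀ t c, m < t → x (t, c) = 0) ∧ ∀ t, ∀ c ∉ bl, x (t, c) = 0 := by
    intro x
    constructor
    · intro h
      exact ⟨fun c => h _ (by simp [mem_positions]),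
        fun t c ht => h _ (by simp [mem_positions]; omega),
        fun t c hc => h _ (by simp [mem_positions, hc])⟩
    · rintro ⟨h1, h2, h3⟩ ⟨t, c⟩ hp
      rw [mem_positions] at hp
      by_cases ht0 : t = 0
      · subst ht0; exact h1 c
      · by_cases htm : t ≤ m
        · exact h3 t c fun hc => hp ⟨by omega, htm, hc⟩
        · exact h2 t c (by omega)
  have hch : ∀ x : ℕ × ℤ → ℤ, (∀ c, x (0, c) = 0) → (∀ t, ∀ c ∉ bl, x (t, c) = 0) →
      {p | p ∈ arrayChanges x ∧ p.1 ≤ m}.encard = walkChanges (positions bl m) x := by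
    intro x h0 hx
    rw [walkChanges_positions h0 hx hnd, ← List.toFinset_card_of_nodup
      ((nodup_positions hnd m).filter _), ← Set.encard_coe_eq_coe_finsetCard]
    congr 1
    ext ⟨t, c⟩
    simp only [arrayChanges, Set.mem_ofPred_eq, List.coe_toFinset, List.mem_filter,
      mem_positions, decide_eq_true_eq]
    constructor
    · rintro ⟨⟨h1, h2⟩, h3⟩
      refine ⟨⟨h1, h3, ?_⟩, h2⟩
      by_contra hc
      exact h2 (by rw [hx _ _ hc, hx _ _ hc])
    · rintro ⟨⟨h1, h2, -⟩, h3⟩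
      exact ⟨⟨h1, h3⟩, h2⟩
  ext x
  constructor
  · rintro ⟨h1, h2, h3, h4⟩
    obtain ⟨h0, hb, hx⟩ := (hsupp x).1 h1
    obtain ⟨h5, h6, h7⟩ := (walkValid_positions_iff hprec h0 hx hbl m).1 h2
    refine ⟨⟨h0, hb, fun t c hc => hx t c (mt (hS c).1 hc), h5, h6, h7⟩, fun c => ?_, ?_⟩
    · rw [← h3, walkState_positions h0 hx]
    · rw [hch x h0 hx, h4]
  · rintro ⟨⟨h0, hb, hx, h5, h6, h7⟩, h3, h4⟩
    have hx' : ∀ t, ∀ c ∉ bl, x (t, c) = 0 := fun t c hc => hx t c (mt (hS c).2 hc)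
    refine ⟨(hsupp x).2 ⟨h0, hb, hx'⟩, (walkValid_positions_iff hprec h0 hx' hbl m).2 ⟨h5, h6, h7⟩,
      ?_, ?_⟩
    · rw [walkState_positions h0 hx']
      exact funext h3
    · rw [hch x h0 hx'] at h4
      exact_mod_cast h4

end BlockWalk

/-! ### Height functions as arrays of diagonal lengths -/

theorem IsPart.add_le {D : ℤ → ℤ} (h : IsPart D) {c : ℤ} (hc : 0 ≤ c) (n : ℕ) :
    D (c + n) ≤ D c := by
  induction n with
  | zero => simp
  | succ n ih =>
    have := h (c + n)
    simp only [Adj] at this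
    push_cast
    rw [← add_assoc]
    omega

theorem IsPart.sub_le {D : ℤ → ℤ} (h : IsPart D) {c : ℤ} (hc : c ≤ 0) (n : ℕ) :
    D (c - n) ≤ D c := by
  induction n with
  | zero => simp
  | succ n ih =>
    have := h (c - n - 1)
    simp only [Adj, sub_add_cancel] at this
    push_cast
    rw [← sub_sub]
    omega

/-- The lengths decrease weakly away from content `0` and vanish far out. -/
theorem IsPart.nonneg {D : ℤ → ℤ} (h : IsPart D) (M : ℕ) (hM : ∀ c, (M : ℤ) ≤ |c| → D c = 0)
    (c : ℤ) : 0 ≤ D c := by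
  rcases le_total 0 c with hc | hc
  · have := h.add_le hc M
    rwa [hM _ (by rw [abs_of_nonneg] <;> omega)] at this
  · have := h.sub_le hc M
    rwa [hM _ (by rw [abs_of_nonpos] <;> omega)] at this

/-- The number of squares of content `j - i` in the partition on a cut through `(i, j)`. -/
def diagLen (h : ℤ → ℤ → ℤ) (i j : ℤ) : ℤ := max (min i j) 0 - h i j

/-- The array of diagonal lengths of a height function. -/
def toArray (a b : ℕ) (h : ℤ → ℤ → ℤ) (p : ℕ × ℤ) : ℤ :=
  if p.1 ≤ min a b then
    diagLen h (min (a : ℤ) (b - p.2) - min (a : ℤ) b + p.1)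
      (min (a : ℤ) (b - p.2) - min (a : ℤ) b + p.1 + p.2)
  else 0

theorem toArray_eq {a b : ℕ} (h : ℤ → ℤ → ℤ) {t : ℕ} {c i j : ℤ} (ht : t ≤ min a b)
    (hi : i = min (a : ℤ) (b - c) - min (a : ℤ) b + t) (hj : j = i + c) :
    toArray a b h (t, c) = diagLen h i j := by
  rw [toArray, if_pos ht, hj, hi]

/-- The diagonal lengths of the partition on the lower right boundary of the rectangle. -/
def boundaryDiag (a b : ℕ) (B : BoundaryPair a b) (c : ℤ) : ℤ :=
  if c ≤ (b : ℤ) - a then max (min (a : ℤ) (a + c)) 0 - colCount B (a + c)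
  else max (min ((b : ℤ) - c) b) 0 - rowCount B (b - c)

section Counts

variable {a b : ℕ} (B : BoundaryPair a b)

theorem colCount_of_nonpos {j : ℤ} (hj : j ≤ 0) : colCount B j = 0 := by
  rw [colCount, Finset.filter_false_of_mem]
  · rfl
  · intro k _
    have := B.one_le_col k
    omega

theorem rowCount_of_nonpos {j : ℤ} (hj : j ≤ 0) : rowCount B j = 0 := by
  rw [rowCount, Finset.filter_false_of_mem]
  · rfl
  · intro k _
    have := B.one_le_row k
    omega

theorem colCount_of_le {j : ℤ} (hj : (b : ℤ) ≤ j) : colCount B j = B.r := by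
  rw [colCount, Finset.filter_true_of_mem]
  · simp
  · intro k _
    have := B.col_le k
    omega

theorem rowCount_of_le {j : ℤ} (hj : (a : ℤ) ≤ j) : rowCount B j = B.r := by
  rw [rowCount, Finset.filter_true_of_mem]
  · simp
  · intro k _
    have := B.row_le k
    omega

end Counts

/-! ### From height functions to arrays -/

namespace IsHeight

variable {a b : ℕ} {B : BoundaryPair a b} {h : ℤ → ℤ → ℤ}

theorem diagLen_of_nonpos (H : IsHeight a b B h) {i j : ℤ} (hij : i ≤ 0 ∨ j ≤ 0) :
    diagLen h i j = 0 := by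
  rw [diagLen, show h i j = 0 from hij.elim (H.top i j) (H.left i j)]
  omega

/-- For positive coordinates, `min i j` grows with `j` exactly at negative contents; subtracting the
`0` or `1` by which `h` grows leaves the two alternatives of `Adj`. -/
theorem adj_right (H : IsHeight a b B h) (i j : ℤ) :
    Adj (j - i) (diagLen h i j) (diagLen h i (j + 1)) := by
  have h1 := H.right i j
  by_cases hi : i ≤ 0
  · rw [H.diagLen_of_nonpos (Or.inl hi), H.diagLen_of_nonpos (Or.inl hi)]
    exact isPart_zero _
  by_cases hj : j + 1 ≤ 0
  · rw [H.diagLen_of_nonpos (Or.inr hj), H.diagLen_of_nonpos (Or.inr (by omega))]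
    exact isPart_zero _
  simp only [Adj, diagLen]
  omega

theorem adj_up (H : IsHeight a b B h) (i j : ℤ) :
    Adj (j - i) (diagLen h i j) (diagLen h (i - 1) j) := by
  have h1 := H.down (i - 1) j
  rw [sub_add_cancel] at h1
  by_cases hi : i ≤ 0
  · rw [H.diagLen_of_nonpos (Or.inl hi), H.diagLen_of_nonpos (Or.inl (by omega))]
    exact isPart_zero _
  by_cases hj : j ≤ 0
  · rw [H.diagLen_of_nonpos (Or.inr hj), H.diagLen_of_nonpos (Or.inr hj)]
    exact isPart_zero _
  simp only [Adj, diagLen]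
  omega

theorem isArray_toArray (H : IsHeight a b B h) {M : ℕ} (hM : a + b ≤ M) :
    IsArray (Finset.Icc (-(M : ℤ)) M) (min a b) ((b : ℤ) - a) (toArray a b h) := by
  refine ⟨fun c => ?_, fun t c ht => ?_, fun t c hc => ?_, fun t ht c => ?_, fun t ht c hc => ?_,
    fun t ht c hc => ?_⟩
  · rw [toArray_eq h (Nat.zero_le _) rfl rfl]
    exact H.diagLen_of_nonpos (by omega)
  · exact if_neg (by simp only; omega)
  · by_cases ht : t ≤ min a b
    -- Contents of absolute value above `a + b` only occur at points with a nonpositive coordinate.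
    · rw [Finset.mem_Icc] at hc
      rw [toArray_eq h ht rfl rfl]
      exact H.diagLen_of_nonpos (by omega)
    · exact if_neg ht
  · simp only
    -- Below the corner content `b - a` the hook runs along a row, above it along a column.
    rcases lt_or_ge c ((b : ℤ) - a) with hc | hc
    · rw [toArray_eq h ht (i := a - min (a : ℤ) b + t) (j := a - min (a : ℤ) b + t + c)
        (by omega) rfl, toArray_eq h ht (i := a - min (a : ℤ) b + t)
        (j := a - min (a : ℤ) b + t + c + 1) (by omega) (by omega)]
      convert H.adj_right _ _ using 1
      omega
    · rw [toArray_eq h ht (i := b - c - min (a : ℤ) b + t) (j := b - min (a : ℤ) b + t)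
        (by omega) (by omega), toArray_eq h ht (i := b - c - min (a : ℤ) b + t - 1)
        (j := b - min (a : ℤ) b + t) (by omega) (by omega)]
      convert H.adj_up _ _ using 1
      omega
  · rw [toArray_eq h (by omega) (i := a - min (a : ℤ) b + t + 1)
      (j := a - min (a : ℤ) b + t + 1 + c) (by omega) rfl,
      toArray_eq h (by omega) (i := a - min (a : ℤ) b + t + 1 - 1)
      (j := a - min (a : ℤ) b + t + 1 + c) (by omega) (by omega)]
    convert H.adj_up _ _ using 1
    omega
  · rw [toArray_eq h (by omega) (i := b - c - min (a : ℤ) b + t) (j := b - min (a : ℤ) b + t)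
      (by omega) (by omega), toArray_eq h (by omega) (i := b - c - min (a : ℤ) b + t)
      (j := b - min (a : ℤ) b + t + 1) (by omega) (by omega)]
    convert H.adj_right _ _ using 1
    omega

theorem toArray_last (H : IsHeight a b B h) (c : ℤ) :
    toArray a b h (min a b, c) = boundaryDiag a b B c := by
  rw [boundaryDiag]
  split_ifs with hc
  · rw [toArray_eq h le_rfl (i := a) (j := a + c) (by omega) rfl, diagLen, H.bottom]
  · rw [toArray_eq h le_rfl (i := b - c) (j := b) (by omega) (by omega), diagLen, H.side]

/-- `f` sends `(t, c)` to the point of content `c` on hook `t`, and `(t - 1, c)` to its diagonal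
predecessor. Between these `min i j` grows by one, so the length changes iff the height does not
grow by exactly one; where a coordinate is nonpositive both lengths vanish. -/
theorem encard_arrayChanges (H : IsHeight a b B h) :
    {p | p ∈ arrayChanges (toArray a b h) ∧ p.1 ≤ min a b}.encard =
      (heightExc a b h).encard := by
  let f : ℕ × ℤ → ℤ × ℤ := fun p => (min (a : ℤ) (b - p.2) - min (a : ℤ) b + p.1,
    min (a : ℤ) (b - p.2) - min (a : ℤ) b + p.1 + p.2)
  have hf : f.Injective := by
    rintro ⟨t, c⟩ ⟨t', c'⟩ hp
    simp only [f, Prod.mk.injEq] at hp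
    refine Prod.ext ?_ ?_ <;> simp only <;> omega
  rw [← hf.encard_image]
  congr 1
  ext ⟨i, j⟩
  constructor
  · rintro ⟨⟨t, c⟩, ⟨⟨h1, h2⟩, h3⟩, h4⟩
    simp only [f, Prod.mk.injEq] at h1 h2 h3 h4
    obtain ⟨hi, hj⟩ := h4
    rw [toArray_eq h h3 hi.symm (by omega : j = i + c),
      toArray_eq h (by omega) (by omega : i - 1 = _) (by omega : j - 1 = _)] at h2
    have hij : 1 ≤ i ∧ 1 ≤ j := by
      by_contra hn
      refine h2 ?_
      rw [H.diagLen_of_nonpos (by omega), H.diagLen_of_nonpos (by omega)]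
    refine ⟨⟨⟨hij.1, ?_⟩, ⟨hij.2, ?_⟩⟩, ?_⟩
    · simp only; omega
    · simp only; omega
    · simp only [diagLen] at h2 ⊢
      omega
  · rintro ⟨hr, hne⟩
    simp only [Set.mem_Icc] at hr hne
    have ht : ((min (a : ℤ) b - min (a - i) (b - j)).toNat : ℤ) =
      min (a : ℤ) b - min (a - i) (b - j) := Int.toNat_of_nonneg (by omega)
    refine ⟨((min (a : ℤ) b - min (a - i) (b - j)).toNat, j - i), ⟨⟨?_, ?_⟩, ?_⟩, ?_⟩
    · simp only; omega
    · simp only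
      rw [toArray_eq h (by omega) (by omega : i = _) (by omega : j = _),
        toArray_eq h (by omega) (by omega : i - 1 = _) (by omega : j - 1 = _)]
      simp only [diagLen]
      omega
    · simp only; omega
    · simp only [f, ht, Prod.mk.injEq]
      omega

end IsHeight

/-! ### From arrays back to height functions -/

namespace IsArray

variable {a b M : ℕ} {x : ℕ × ℤ → ℤ}

theorem nonneg {m : ℕ} {q : ℤ} (X : IsArray (Finset.Icc (-(M : ℤ)) M) m q x) (t : ℕ) (c : ℤ) :
    0 ≤ x (t, c) := by
  rcases le_or_gt t m with ht | ht
  · refine (X.part t ht).nonneg (M + 1) (fun c hc => X.outside t c ?_) c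
    rw [Finset.mem_Icc, ← abs_le]
    push_cast at hc
    omega
  · rw [X.beyond t c ht]

variable (X : IsArray (Finset.Icc (-(M : ℤ)) M) (min a b) ((b : ℤ) - a) x)
include X

/-- These positions are points in rows `i ≤ 0`. Moving to content `c - 1` on the previous hook stays
in the same row and eventually reaches hook `0`; zero then propagates back, since at nonnegative
contents the new length cannot exceed the old one. Columns `j ≤ 0` are treated symmetrically in
`eq_zero_of_nonpos`. -/
theorem eq_zero_of_nonneg (t : ℕ) (ht : t ≤ min a b) (c : ℤ) (hc : 0 ≤ c)
    (h : min (a : ℤ) (b - c) - min (a : ℤ) b + t ≤ 0) : x (t, c) = 0 := by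
  induction t generalizing c with
  | zero => exact X.zero c
  | succ t ih =>
    push_cast at h
    have h1 := X.right t (by omega) (c - 1) (by omega)
    rw [ih (by omega) (c - 1) (by omega) (by omega), sub_add_cancel] at h1
    have h2 := X.nonneg (t + 1) c
    simp only [Adj] at h1
    omega

theorem eq_zero_of_nonpos (t : ℕ) (ht : t ≤ min a b) (c : ℤ) (hc : c ≤ 0)
    (h : min ((a : ℤ) + c) b - min (a : ℤ) b + t ≤ 0) : x (t, c) = 0 := by
  induction t generalizing c with
  | zero => exact X.zero c
  | succ t ih =>
    push_cast at h
    have h1 := X.left t (by omega) c (by omega)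
    rw [ih (by omega) (c + 1) (by omega) (by omega)] at h1
    have h2 := X.nonneg (t + 1) c
    simp only [Adj] at h1
    omega

end IsArray

/-- The diagonal length at `(i, j)` recorded by the array `x`. -/
def arrayAt (a b : ℕ) (x : ℕ × ℤ → ℤ) (i j : ℤ) : ℤ :=
  x ((min (a : ℤ) b - min (a - i) (b - j)).toNat, j - i)

/-- The height function with array `x`. -/
def ofArray (a b : ℕ) (x : ℕ × ℤ → ℤ) (i j : ℤ) : ℤ :=
  max (min (min i a) (min j b)) 0 - arrayAt a b x (min i a) (min j b)

theorem arrayAt_eq {a b : ℕ} {x : ℕ × ℤ → ℤ} {i j : ℤ} {t : ℕ} {c : ℤ}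
    (ht : (t : ℤ) = min (a : ℤ) b - min (a - i) (b - j)) (hc : c = j - i) :
    arrayAt a b x i j = x (t, c) := by
  rw [arrayAt, ← ht, Int.toNat_natCast, hc]

namespace IsArray

variable {a b M : ℕ} {x : ℕ × ℤ → ℤ}
  (X : IsArray (Finset.Icc (-(M : ℤ)) M) (min a b) ((b : ℤ) - a) x)
include X

theorem arrayAt_of_nonpos {i j : ℤ} (hi : i ≤ a) (hj : j ≤ b) (hij : i ≤ 0 ∨ j ≤ 0) :
    arrayAt a b x i j = 0 := by
  rcases le_or_gt (min (a : ℤ) b - min (a - i) (b - j)) 0 with hle | hgt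
  -- Nonpositive hook numbers are truncated to hook `0`, where the array vanishes.
  · rw [arrayAt, Int.toNat_of_nonpos hle, X.zero]
  · obtain ⟨t, ht⟩ := Int.eq_ofNat_of_zero_le hgt.le
    rw [arrayAt_eq ht.symm rfl]
    rcases le_total 0 (j - i) with hc | hc
    · exact X.eq_zero_of_nonneg t (by omega) _ hc (by omega)
    · exact X.eq_zero_of_nonpos t (by omega) _ hc (by omega)

theorem arrayAt_right {i j : ℤ} (hi : i ≤ a) (hj : j + 1 ≤ b) :
    Adj (j - i) (arrayAt a b x i j) (arrayAt a b x i (j + 1)) := by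
  by_cases hij : i ≤ 0 ∨ j + 1 ≤ 0
  · rw [X.arrayAt_of_nonpos hi hj hij, X.arrayAt_of_nonpos hi (by omega) (by omega)]
    exact isPart_zero _
  · rcases lt_or_ge (j - i) ((b : ℤ) - a) with hc | hc
    · obtain ⟨t, ht⟩ := Int.eq_ofNat_of_zero_le
        (show 0 ≤ min (a : ℤ) b - (a - i) by omega)
      rw [arrayAt_eq (t := t) (by omega) rfl,
        arrayAt_eq (t := t) (c := j - i + 1) (by omega) (by omega)]
      exact X.part t (by omega) _
    · obtain ⟨t, ht⟩ := Int.eq_ofNat_of_zero_le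
        (show 0 ≤ min (a : ℤ) b - (b - j) by omega)
      rw [arrayAt_eq (t := t) (by omega) rfl,
        arrayAt_eq (t := t + 1) (c := j - i + 1) (by omega) (by omega)]
      exact X.right t (by omega) _ hc

theorem arrayAt_up {i j : ℤ} (hi : i ≤ a) (hj : j ≤ b) :
    Adj (j - i) (arrayAt a b x i j) (arrayAt a b x (i - 1) j) := by
  by_cases hij : i ≤ 0 ∨ j ≤ 0
  · rw [X.arrayAt_of_nonpos hi hj hij, X.arrayAt_of_nonpos (by omega) hj (by omega)]
    exact isPart_zero _
  · rcases lt_or_ge (j - i) ((b : ℤ) - a) with hc | hc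
    · obtain ⟨t, ht⟩ := Int.eq_ofNat_of_zero_le
        (show 0 ≤ min (a : ℤ) b - (a - i) - 1 by omega)
      rw [arrayAt_eq (t := t + 1) (by omega) rfl,
        arrayAt_eq (t := t) (c := j - i + 1) (by omega) (by omega)]
      exact X.left t (by omega) _ hc
    · obtain ⟨t, ht⟩ := Int.eq_ofNat_of_zero_le
        (show 0 ≤ min (a : ℤ) b - (b - j) by omega)
      rw [arrayAt_eq (t := t) (by omega) rfl,
        arrayAt_eq (t := t) (c := j - i + 1) (by omega) (by omega)]
      exact X.part t (by omega) _

theorem isHeight_ofArray {B : BoundaryPair a b}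
    (hB : ∀ c, x (min a b, c) = boundaryDiag a b B c) : IsHeight a b B (ofArray a b x) := by
  have zero : ∀ i j : ℤ, i ≤ 0 ∨ j ≤ 0 → ofArray a b x i j = 0 := by
    intro i j hij
    rw [ofArray, X.arrayAt_of_nonpos (min_le_right _ _) (min_le_right _ _) (by omega)]
    omega
  have bottom : ∀ j ≤ (b : ℤ), ofArray a b x a j = colCount B j := by
    intro j hj
    rw [ofArray, min_self, min_eq_left hj, arrayAt_eq (t := min a b) (by omega) rfl, hB,
      boundaryDiag, if_pos (by omega), add_sub_cancel]
    omega
  have side : ∀ i ≤ (a : ℤ), ofArray a b x i b = rowCount B i := by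
    intro i hi
    rcases hi.lt_or_eq with hlt | rfl
    · rw [ofArray, min_self, min_eq_left hi, arrayAt_eq (t := min a b) (by omega) rfl, hB,
        boundaryDiag, if_neg (by omega), sub_sub_cancel]
      omega
    -- The lower right corner is covered by the bottom row; both counts there equal `r`.
    · rw [bottom _ le_rfl, colCount_of_le B le_rfl, rowCount_of_le B le_rfl]
  have clamp : ∀ i j, ofArray a b x i j = ofArray a b x (min i a) (min j b) := by
    intro i j
    rw [ofArray, ofArray, min_eq_left (min_le_right i (a : ℤ)),
      min_eq_left (min_le_right j (b : ℤ))]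
  refine ⟨fun i j => ?_, fun i j => ?_, fun i j hi => zero i j (Or.inl hi),
    fun i j hj => zero i j (Or.inr hj), clamp, fun j => ?_, fun i => ?_⟩
  · by_cases hij : i + 1 ≤ 0 ∨ j ≤ 0
    · left
      rw [zero _ _ hij, zero _ _ (by omega)]
    by_cases hi : i + 1 ≤ a
    · have h1 := X.arrayAt_up hi (min_le_right j b)
      rw [add_sub_cancel_right] at h1
      rw [ofArray, ofArray, min_eq_left hi, min_eq_left (by omega : i ≤ a)]
      simp only [Adj] at h1
      omega
    · left
      rw [clamp, clamp i, min_eq_right (by omega : (a : ℤ) ≤ i + 1),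
        min_eq_right (by omega : (a : ℤ) ≤ i)]
  · by_cases hij : i ≤ 0 ∨ j + 1 ≤ 0
    · left
      rw [zero _ _ hij, zero _ _ (by omega)]
    by_cases hj : j + 1 ≤ b
    · have h1 := X.arrayAt_right (min_le_right i a) hj
      rw [ofArray, ofArray, min_eq_left hj, min_eq_left (by omega : j ≤ b)]
      simp only [Adj] at h1
      omega
    · left
      rw [clamp, clamp i j, min_eq_right (by omega : (b : ℤ) ≤ j + 1),
        min_eq_right (by omega : (b : ℤ) ≤ j)]
  · rcases le_total j b with hj | hj
    · exact bottom j hj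
    · rw [clamp, min_self, min_eq_right hj, bottom _ le_rfl, colCount_of_le B hj,
        colCount_of_le B le_rfl]
  · rcases le_total i a with hi | hi
    · exact side i hi
    · rw [clamp, min_self, min_eq_right hi, side _ le_rfl, rowCount_of_le B hi,
        rowCount_of_le B le_rfl]

theorem toArray_ofArray : toArray a b (ofArray a b x) = x := by
  funext ⟨t, c⟩
  by_cases ht : t ≤ min a b
  · obtain ⟨i, hi⟩ : ∃ i, i = min (a : ℤ) (b - c) - min (a : ℤ) b + t := ⟨_, rfl⟩
    rw [toArray_eq _ ht hi rfl, diagLen, ofArray, min_eq_left (show i ≤ a by omega),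
      min_eq_left (show i + c ≤ b by omega),
      arrayAt_eq (t := t) (c := c) (by omega) (by omega), sub_sub_cancel]
  · rw [toArray, if_neg ht, X.beyond t c (by omega)]

end IsArray

theorem IsHeight.eq_of_toArray_eq {a b : ℕ} {B : BoundaryPair a b} {h h' : ℤ → ℤ → ℤ}
    (H : IsHeight a b B h) (H' : IsHeight a b B h') (he : toArray a b h = toArray a b h') :
    h = h' := by
  funext i j
  rw [H.clamp, H'.clamp]
  have hi : min i a ≤ a := min_le_right _ _
  have hj : min j b ≤ b := min_le_right _ _
  generalize min i (a : ℤ) = i at hi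
  generalize min j (b : ℤ) = j at hj
  by_cases hij : i ≤ 0 ∨ j ≤ 0
  · rcases hij with h0 | h0
    · rw [H.top _ _ h0, H'.top _ _ h0]
    · rw [H.left _ _ h0, H'.left _ _ h0]
  · obtain ⟨t, ht⟩ := Int.eq_ofNat_of_zero_le
      (show 0 ≤ min (a : ℤ) b - min (a - i) (b - j) by omega)
    have h1 := congrFun he (t, j - i)
    rw [toArray_eq h (by omega) (by omega : i = _) (by omega : j = _),
      toArray_eq h' (by omega) (by omega : i = _) (by omega : j = _), diagLen, diagLen] at h1
    omega

theorem toArray_bijOn (a b : ℕ) (B : BoundaryPair a b) (l M : ℕ) (hM : a + b ≤ M) :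
    Set.BijOn (toArray a b) {h | IsHeight a b B h ∧ (heightExc a b h).encard = l}
      {x | IsArray (Finset.Icc (-(M : ℤ)) M) (min a b) ((b : ℤ) - a) x ∧
        (∀ c, x (min a b, c) = boundaryDiag a b B c) ∧
        {p | p ∈ arrayChanges x ∧ p.1 ≤ min a b}.encard = l} := by
  refine ⟨fun h H => ⟨H.1.isArray_toArray hM, H.1.toArray_last, ?_⟩,
    fun h H h' H' he => H.1.eq_of_toArray_eq H'.1 he, fun x X => ?_⟩
  · rw [H.1.encard_arrayChanges, H.2]
  · obtain ⟨X, hB, hl⟩ := X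
    have H := X.isHeight_ofArray hB
    refine ⟨_, ⟨H, ?_⟩, X.toArray_ofArray⟩
    rw [← H.encard_arrayChanges, X.toArray_ofArray, hl]

/-! ### Diagonal lengths of Young diagrams -/

theorem exists_diagonal_notMem (μ : YoungDiagram) (c : ℤ) :
    ∃ n : ℕ, (n + (-c).toNat, n + c.toNat) ∉ μ := by
  refine ⟨μ.colLen 0, fun h => ?_⟩
  have h1 : (μ.colLen 0, 0) ∈ μ := μ.up_left_mem (by omega) (by omega) h
  rw [YoungDiagram.mem_iff_lt_colLen] at h1
  exact lt_irrefl _ h1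

open Classical in
/-- The number of squares of content `c` in `μ`. -/
noncomputable def diag (μ : YoungDiagram) (c : ℤ) : ℤ := (Nat.find (exists_diagonal_notMem μ c) : ℤ)

theorem diag_nonneg (μ : YoungDiagram) (c : ℤ) : 0 ≤ diag μ c := Nat.cast_nonneg _

theorem lt_diag_iff (μ : YoungDiagram) (c : ℤ) (n : ℕ) :
    (n : ℤ) < diag μ c ↔ (n + (-c).toNat, n + c.toNat) ∈ μ := by
  classical
  rw [diag, Nat.cast_lt]
  constructor
  · intro h
    exact not_not.1 (Nat.find_min _ h)
  · intro h
    by_contra hn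
    exact Nat.find_spec (exists_diagonal_notMem μ c)
      (μ.up_left_mem (by omega) (by omega) h)

theorem mem_iff_lt_diag (μ : YoungDiagram) (i j : ℕ) :
    (i, j) ∈ μ ↔ min (i : ℤ) j < diag μ (j - i) := by
  have h := lt_diag_iff μ (j - i) (min i j)
  rw [Nat.cast_min] at h
  rw [h]
  congr! 2 <;> omega

theorem diag_eq_of_mem_iff {μ : YoungDiagram} {D : ℤ → ℤ} (h0 : ∀ c, 0 ≤ D c)
    (h : ∀ i j : ℕ, (i, j) ∈ μ ↔ min (i : ℤ) j < D (j - i)) : diag μ = D := by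
  funext c
  have key : ∀ n : ℕ, (n : ℤ) < diag μ c ↔ (n : ℤ) < D c := by
    intro n
    rw [lt_diag_iff, h]
    have h1 : ((n + c.toNat : ℕ) : ℤ) - (n + (-c).toNat : ℕ) = c := by omega
    rw [h1]
    omega
  have h1 := key (diag μ c).toNat
  have h2 := key (D c).toNat
  rw [Int.toNat_of_nonneg (diag_nonneg _ _)] at h1
  rw [Int.toNat_of_nonneg (h0 _)] at h2
  omega

theorem diag_injective : Function.Injective diag := by
  intro μ ν h
  ext ⟨i, j⟩
  rw [YoungDiagram.mem_cells, YoungDiagram.mem_cells, mem_iff_lt_diag, mem_iff_lt_diag, h]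

theorem diag_bot : diag ⊥ = 0 :=
  diag_eq_of_mem_iff (fun _ => le_rfl) fun i j => by
    simp only [YoungDiagram.notMem_bot, Pi.zero_apply, false_iff]
    omega

theorem isPart_diag (μ : YoungDiagram) : IsPart (diag μ) := by
  intro c
  have h0 := diag_nonneg μ c
  have h1 := diag_nonneg μ (c + 1)
  have down : ∀ {i j i' j' : ℕ}, i ≤ i' → j ≤ j' → min (i' : ℤ) j' < diag μ (j' - i') →
      min (i : ℤ) j < diag μ (j - i) := by
    intro i j i' j' hi hj h
    rw [← mem_iff_lt_diag] at h ⊢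
    exact μ.up_left_mem hi hj h
  obtain ⟨u, hu⟩ := Int.eq_ofNat_of_zero_le h0
  obtain ⟨v, hv⟩ := Int.eq_ofNat_of_zero_le h1
  rcases le_or_gt 0 c with hc | hc
  · refine Or.inl ⟨hc, ?_⟩
    obtain ⟨d, rfl⟩ := Int.eq_ofNat_of_zero_le hc
    by_contra hne
    rcases lt_or_ge u v with h | h
    · have := down (i := u) (j := u + d) (i' := u) (j' := u + d + 1) le_rfl (by omega)
        (by rw [show ((u + d + 1 : ℕ) : ℤ) - u = (d : ℤ) + 1 by omega]; omega)
      rw [show ((u + d : ℕ) : ℤ) - u = (d : ℤ) by omega] at this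
      omega
    · have := down (i := v) (j := v + d + 1) (i' := v + 1) (j' := v + d + 1) (by omega) le_rfl
        (by rw [show ((v + d + 1 : ℕ) : ℤ) - (v + 1 : ℕ) = (d : ℤ) by omega]; omega)
      rw [show ((v + d + 1 : ℕ) : ℤ) - v = (d : ℤ) + 1 by omega] at this
      omega
  · refine Or.inr ⟨hc, ?_⟩
    obtain ⟨d, hd⟩ := Int.eq_ofNat_of_zero_le (show 0 ≤ -c - 1 by omega)
    obtain rfl : c = -(d : ℤ) - 1 := by omega
    by_contra hne
    rcases lt_or_ge v u with h | h
    · have := down (i := v + d) (j := v) (i' := v + d + 1) (j' := v) (by omega) le_rfl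
        (by rw [show (v : ℤ) - (v + d + 1 : ℕ) = -(d : ℤ) - 1 by omega]; omega)
      rw [show (v : ℤ) - (v + d : ℕ) = -(d : ℤ) - 1 + 1 by omega] at this
      omega
    · have := down (i := u + d + 1) (j := u) (i' := u + d + 1) (j' := u + 1) le_rfl (by omega)
        (by rw [show ((u + 1 : ℕ) : ℤ) - (u + d + 1 : ℕ) = -(d : ℤ) - 1 + 1 by omega]; omega)
      rw [show (u : ℤ) - (u + d + 1 : ℕ) = -(d : ℤ) - 1 by omega] at this
      omega

/-- All lengths are at most `D 0` and vanish for `|c| ≥ M`, so the diagram fits into a square of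
side `M + D 0`. `Adj` gives closure under single steps up and left. -/
theorem exists_diag_eq {D : ℤ → ℤ} (h : IsPart D) (M : ℕ) (hM : ∀ c, (M : ℤ) ≤ |c| → D c = 0) :
    ∃ μ, diag μ = D := by
  have h0 := h.nonneg M hM
  have hle : ∀ c, D c ≤ D 0 := by
    intro c
    rcases le_total 0 c with hc | hc
    · have := h.add_le le_rfl c.toNat
      rwa [show (0 : ℤ) + c.toNat = c by omega] at this
    · have := h.sub_le le_rfl (-c).toNat
      rwa [show (0 : ℤ) - (-c).toNat = c by omega] at this
  have hbd : ∀ i j : ℕ, min (i : ℤ) j < D (j - i) →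
      i < M + (D 0).toNat ∧ j < M + (D 0).toNat := by
    intro i j hij
    have h1 := hle (j - i)
    have h2 : |(j : ℤ) - i| < M := by
      by_contra hn
      rw [hM _ (by omega)] at hij
      omega
    rw [abs_lt] at h2
    have := h0 0
    omega
  have hup : ∀ i j : ℕ, min ((i + 1 : ℕ) : ℤ) j < D (j - (i + 1 : ℕ)) →
      min (i : ℤ) j < D (j - i) := by
    intro i j hij
    have h1 := h (j - (i + 1 : ℕ))
    rw [show (j : ℤ) - (i + 1 : ℕ) + 1 = j - i by omega] at h1
    simp only [Adj] at h1
    omega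
  have hleft : ∀ i j : ℕ, min (i : ℤ) (j + 1 : ℕ) < D ((j + 1 : ℕ) - i) →
      min (i : ℤ) j < D (j - i) := by
    intro i j hij
    have h1 := h (j - i)
    rw [show (j : ℤ) - i + 1 = (j + 1 : ℕ) - i by omega] at h1
    simp only [Adj] at h1
    omega
  have hlow : ∀ i j i' j' : ℕ, i' ≤ i → j' ≤ j → min (i : ℤ) j < D (j - i) →
      min (i' : ℤ) j' < D (j' - i') := by
    intro i j i' j' hi hj hij
    have h1 : min (i' : ℤ) j < D (j - i') :=
      Nat.decreasingInduction' (P := fun k => min (k : ℤ) j < D (j - k))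
        (fun k _ _ hk => hup k j hk) hi hij
    exact Nat.decreasingInduction' (P := fun k => min (i' : ℤ) k < D (k - i'))
      (fun k _ _ hk => hleft i' k hk) hj h1
  let μ : YoungDiagram :=
    { cells := (Finset.range (M + (D 0).toNat) ×ˢ Finset.range (M + (D 0).toNat)).filter
        fun p => min (p.1 : ℤ) p.2 < D (p.2 - p.1)
      isLowerSet := by
        rintro ⟨i, j⟩ ⟨i', j'⟩ ⟨hi, hj⟩ hmem
        simp only [Finset.coe_filter, Finset.mem_product, Finset.mem_range,
          Set.mem_ofPred_eq] at hi hj hmem ⊢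
        have h1 := hlow i j i' j' hi hj hmem.2
        exact ⟨hbd _ _ h1, h1⟩ }
  refine ⟨μ, diag_eq_of_mem_iff h0 fun i j => ?_⟩
  rw [← YoungDiagram.mem_cells]
  simp only [μ, Finset.mem_filter, Finset.mem_product, Finset.mem_range]
  exact ⟨fun h => h.2, fun h => ⟨hbd _ _ h, h⟩⟩

theorem tog_of_differBySquare {μ ν : YoungDiagram} (h : DifferBySquare μ ν) :
    Tog (diagDiff μ ν) (diag μ) (diag ν) := by
  obtain ⟨⟨i, j⟩, h⟩ := h
  have hd : diagDiff μ ν = (j : ℤ) - i := by rw [diagDiff, h, Finset.sum_singleton]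
  have hm : ∀ p : ℕ × ℕ, (p ∈ μ ∧ p ∉ ν ∨ p ∈ ν ∧ p ∉ μ) ↔ p = (i, j) := by
    intro p
    have := Finset.ext_iff.1 h p
    simpa only [Finset.mem_symmDiff, YoungDiagram.mem_cells, Finset.mem_singleton] using this
  rw [hd]
  refine ⟨fun c hc => ?_, fun he => ?_, isPart_diag μ, isPart_diag ν⟩
  · have key : ∀ n : ℕ, (n : ℤ) < diag μ c ↔ (n : ℤ) < diag ν c := by
      intro n
      rw [lt_diag_iff, lt_diag_iff]
      have h1 := mt (hm (n + (-c).toNat, n + c.toNat)).1 (by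
        rw [Prod.mk.injEq]
        omega)
      tauto
    have h1 := key (diag μ c).toNat
    have h2 := key (diag ν c).toNat
    rw [Int.toNat_of_nonneg (diag_nonneg _ _)] at h1 h2
    omega
  · have h1 := (hm (i, j)).2 rfl
    rw [mem_iff_lt_diag, mem_iff_lt_diag, he] at h1
    tauto

/-- The two lengths at `c` differ by one, so the extra square is the one whose index on that
diagonal is the smaller length. -/
theorem differBySquare_of_tog {μ ν : YoungDiagram} {c : ℤ} (h : Tog c (diag μ) (diag ν)) :
    DifferBySquare μ ν ∧ diagDiff μ ν = c := by
  have h0 := diag_nonneg μ c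
  have h1 := diag_nonneg ν c
  have key : symmDiff μ.cells ν.cells = {((min (diag μ c) (diag ν c)).toNat + (-c).toNat,
      (min (diag μ c) (diag ν c)).toNat + c.toNat)} := by
    ext ⟨i, j⟩
    rw [Finset.mem_symmDiff, Finset.mem_singleton, YoungDiagram.mem_cells, YoungDiagram.mem_cells,
      mem_iff_lt_diag, mem_iff_lt_diag, Prod.mk.injEq]
    by_cases hc : (j : ℤ) - i = c
    · rw [hc]
      have a1 := h.left c
      have a2 := h.right c
      have b1 := h.left (c - 1)
      have b2 := h.right (c - 1)
      rw [sub_add_cancel] at b1 b2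
      rw [h.agree (c + 1) (by omega)] at a2
      rw [h.agree (c - 1) (by omega)] at b2
      have hne := h.ne
      simp only [Adj] at a1 a2 b1 b2
      omega
    · rw [h.agree _ hc]
      omega
  refine ⟨⟨_, key⟩, ?_⟩
  rw [diagDiff, key, Finset.sum_singleton]
  push_cast
  omega

/-! ### Oscillating tableaux as words -/

/-- The word of an oscillating tableau, whose last letter comes first. -/
def word {l : ℕ} (η : Fin (l + 1) → YoungDiagram) : List ℤ := (List.ofFn (profile η)).reverse

theorem word_succ {l : ℕ} (η : Fin (l + 2) → YoungDiagram) :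
    word η = diagDiff (η (Fin.last l).castSucc) (η (Fin.last (l + 1))) ::
      word fun k : Fin (l + 1) => η k.castSucc := by
  rw [word, List.ofFn_succ', List.concat_eq_append, List.reverse_append]
  rfl

theorem OT_zero (μ : YoungDiagram) (η : Fin 1 → YoungDiagram) :
    η ∈ OT μ 0 ↔ η 0 = ⊥ ∧ μ = ⊥ := by
  constructor
  · rintro ⟨h1, h2, -⟩
    exact ⟨h1, h2.symm.trans h1⟩
  · rintro ⟨h1, rfl⟩
    exact ⟨h1, h1, fun k => k.elim0⟩

theorem OT_succ {l : ℕ} (μ : YoungDiagram) (η : Fin (l + 2) → YoungDiagram) :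
    η ∈ OT μ (l + 1) ↔ η (Fin.last (l + 1)) = μ ∧
      (fun k : Fin (l + 1) => η k.castSucc) ∈ OT (η (Fin.last l).castSucc) l ∧
      DifferBySquare (η (Fin.last l).castSucc) μ := by
  constructor
  · rintro ⟨h1, h2, h3⟩
    refine ⟨h2, ⟨h1, rfl, fun k => h3 k.castSucc⟩, ?_⟩
    have := h3 (Fin.last l)
    rwa [Fin.succ_last, h2] at this
  · rintro ⟨h1, ⟨h2, -, h3⟩, h4⟩
    refine ⟨h2, h1, fun k => ?_⟩
    induction k using Fin.lastCases with
    | last => rwa [Fin.succ_last, h1]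
    | cast k => exact h3 k

/-- The final shape and the last content determine the preceding shape, by `Tog.unique` and
`diag_injective`. Surjectivity needs every state of a run to come from a diagram; `Runs.eq_zero`
supplies the bounded support for `exists_diag_eq`. -/
theorem word_bijOn (μ : YoungDiagram) (l : ℕ) : Set.BijOn word (OT μ l) (words (diag μ) l) := by
  refine ⟨fun η h => ⟨by simp [word], ?_⟩, ?_, ?_⟩
  · induction l generalizing μ with
    | zero =>
      rw [OT_zero] at h
      rw [h.2, diag_bot]
      exact rfl
    | succ l ih =>
      rw [OT_succ] at h
      rw [word_succ, h.1]
      exact ⟨_, ih _ _ h.2.1, tog_of_differBySquare h.2.2⟩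
  · induction l generalizing μ with
    | zero =>
      intro η h η' h' _
      funext k
      obtain rfl : k = 0 := Fin.ext (by omega)
      rw [((OT_zero _ _).1 h).1, ((OT_zero _ _).1 h').1]
    | succ l ih =>
      intro η h η' h' hw
      rw [OT_succ] at h h'
      rw [word_succ, word_succ, List.cons.injEq, h.1, h'.1] at hw
      have h1 := tog_of_differBySquare h.2.2
      have h2 := tog_of_differBySquare h'.2.2
      rw [hw.1] at h1
      have h3 := diag_injective (h1.symm.unique h2.symm)
      have h4 := h.2.1
      rw [h3] at h4
      have h5 := ih _ h4 h'.2.1 hw.2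
      funext k
      induction k using Fin.lastCases with
      | last => rw [h.1, h'.1]
      | cast k => exact congrFun h5 k
  · induction l generalizing μ with
    | zero =>
      rintro s ⟨hl, hs⟩
      rw [List.length_eq_zero_iff] at hl
      subst hl
      refine ⟨fun _ => ⊥, (OT_zero _ _).2 ⟨rfl, diag_injective ?_⟩, rfl⟩
      rw [diag_bot]
      exact hs
    | succ l ih =>
      rintro (_ | ⟨c, s⟩) ⟨hl, hs⟩
      · simp at hl
      · obtain ⟨D, hs, ht⟩ := hs
        obtain ⟨ν, rfl⟩ := exists_diag_eq ht.left s.length hs.eq_zero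
        obtain ⟨η, hη, rfl⟩ := ih ν ⟨by simpa using hl, hs⟩
        obtain ⟨hd, hc⟩ := differBySquare_of_tog ht
        have hlast : η (Fin.last l) = ν := hη.2.1
        refine ⟨Fin.snoc (α := fun _ => YoungDiagram) η μ, ?_, ?_⟩
        · rw [OT_succ]
          simp only [Fin.snoc_last, Fin.snoc_castSucc, hlast]
          exact ⟨trivial, hη, hd⟩
        · rw [word_succ]
          simp only [Fin.snoc_last, Fin.snoc_castSucc, hlast, hc]

theorem asc_eq_ascW (prec : ℤ → ℤ → Prop) {l : ℕ} (η : Fin (l + 1) → YoungDiagram) :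
    asc prec η = ascW prec (word η) := by
  classical
  induction l with
  | zero =>
    have : ascents prec η = ∅ := Set.eq_empty_of_forall_notMem fun k => k.elim0
    rw [asc, this, Set.ncard_empty]
    rfl
  | succ l ih =>
    have h1 := ih fun k : Fin (l + 1) => η k.castSucc
    cases l with
    | zero =>
      have : ascents prec η = ∅ := Set.eq_empty_of_forall_notMem fun k hk => by
        obtain ⟨hk, -⟩ := hk
        omega
      rw [asc, this, Set.ncard_empty]
      rfl
    | succ l =>
      have hsplit : ascents prec η = Fin.castSucc ''
          ascents prec (fun k : Fin (l + 2) => η k.castSucc) ∪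
          {k | k = (Fin.last l).castSucc ∧
            prec (profile η (Fin.last l).castSucc) (profile η (Fin.last (l + 1)))} := by
        ext k
        constructor
        · rintro ⟨hk, hp⟩
          by_cases hkl : (k : ℕ) = l
          · right
            obtain rfl : k = (Fin.last l).castSucc := Fin.ext hkl
            exact ⟨rfl, hp⟩
          · left
            exact ⟨⟨k, by omega⟩, ⟨by simp only; omega, hp⟩, rfl⟩
        · rintro (⟨k, ⟨hk, hp⟩, rfl⟩ | ⟨rfl, hp⟩)
          · exact ⟨by simp only [Fin.val_castSucc]; omega, hp⟩
          · exact ⟨by simp, hp⟩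
      have hdisj : Disjoint (Fin.castSucc ''
          ascents prec (fun k : Fin (l + 2) => η k.castSucc))
          {k | k = (Fin.last l).castSucc ∧
            prec (profile η (Fin.last l).castSucc) (profile η (Fin.last (l + 1)))} := by
        rw [Set.disjoint_left]
        rintro _ ⟨k, ⟨hk, -⟩, rfl⟩ ⟨hkl, -⟩
        have := congrArg Fin.val hkl
        simp at this
        omega
      rw [asc, hsplit, Set.ncard_union_eq hdisj (Set.toFinite _) (Set.toFinite _),
        Set.InjOn.ncard_image (Fin.castSucc_injective _).injOn]
      rw [asc] at h1
      rw [h1, word_succ η, word_succ fun k : Fin (l + 2) => η k.castSucc, ascW]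
      congr 1
      by_cases hp : prec (profile η (Fin.last l).castSucc) (profile η (Fin.last (l + 1)))
      · refine Eq.trans ?_ (if_pos hp).symm
        simp [hp]
      · refine Eq.trans ?_ (if_neg hp).symm
        simp [hp]

/-! ### The shape and the main theorem -/

theorem mem_frobenius_iff {r : ℕ} (γ δ : Fin r → ℕ) (hγ : StrictAnti γ) (hδ : StrictAnti δ)
    (i j : ℕ) : (i, j) ∈ (frobenius γ δ hγ hδ).cells ↔
      (∃ k : Fin r, (k : ℕ) = i ∧ i ≤ j ∧ j - i ≤ γ k) ∨
        ∃ k : Fin r, (k : ℕ) = j ∧ j ≤ i ∧ i - j ≤ δ k := by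
  simp only [frobenius, Finset.mem_biUnion, Finset.mem_univ, true_and, Finset.mem_union,
    Finset.mem_image, Finset.mem_range, Prod.mk.injEq]
  rw [exists_or]
  refine or_congr (exists_congr fun k => ⟨?_, ?_⟩) (exists_congr fun k => ⟨?_, ?_⟩)
  · rintro ⟨t, h1, h2, h3⟩
    omega
  · rintro ⟨h1, h2, h3⟩
    exact ⟨j - i, by omega, by omega, by omega⟩
  · rintro ⟨t, h1, h2, h3⟩
    omega
  · rintro ⟨h1, h2, h3⟩
    exact ⟨i - j, by omega, by omega, by omega⟩

section Shape

variable {a b : ℕ} (B : BoundaryPair a b)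

theorem r_le_left : B.r ≤ a := by
  have := Finset.card_le_card B.α_subset
  rwa [Nat.card_Icc, Nat.add_sub_cancel] at this

theorem r_le_right : B.r ≤ b := by
  have := Finset.card_le_card B.β_subset
  rwa [Nat.card_Icc, Nat.add_sub_cancel, B.card_eq] at this

theorem colCount_le_self {j : ℤ} (hj : 0 ≤ j) : colCount B j ≤ j := by
  have h : (Finset.univ.filter fun k : Fin B.r => (B.col k : ℤ) ≤ j).card ≤
      (Finset.Icc 1 j.toNat).card := by
    refine Finset.card_le_card_of_injOn B.col (fun k hk => ?_) B.col_strictMono.injective.injOn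
    have hk : (B.col k : ℤ) ≤ j := by simpa using hk
    have := B.one_le_col k
    simp only [Finset.coe_Icc, Set.mem_Icc]
    omega
  rw [Nat.card_Icc, Nat.add_sub_cancel] at h
  rw [colCount]
  omega

theorem rowCount_le_self {j : ℤ} (hj : 0 ≤ j) : rowCount B j ≤ j := by
  have h : (Finset.univ.filter fun k : Fin B.r => (B.row k : ℤ) ≤ j).card ≤
      (Finset.Icc 1 j.toNat).card := by
    refine Finset.card_le_card_of_injOn B.row (fun k hk => ?_) B.row_strictMono.injective.injOn
    have hk : (B.row k : ℤ) ≤ j := by simpa using hk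
    have := B.one_le_row k
    simp only [Finset.coe_Icc, Set.mem_Icc]
    omega
  rw [Nat.card_Icc, Nat.add_sub_cancel] at h
  rw [rowCount]
  omega

theorem boundaryDiag_nonneg (c : ℤ) : 0 ≤ boundaryDiag a b B c := by
  have hr := r_le_left B
  have hr' := r_le_right B
  rw [boundaryDiag]
  split_ifs with hc
  · have h1 := colCount_le B (a + c)
    rcases le_total ((a : ℤ) + c) 0 with h | h
    · rw [colCount_of_nonpos B h]
      omega
    · have := colCount_le_self B h
      omega
  · have h1 := rowCount_le B (b - c)
    rcases le_total ((b : ℤ) - c) 0 with h | h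
    · rw [rowCount_of_nonpos B h]
      omega
    · have := rowCount_le_self B h
      omega

/-- Complementation turns content `c` into `b - a - c`. Arms of the Frobenius diagram land at
contents up to `b - a`, where `a - 1 - i` is the path index and the arm condition reads `col k ≤ a +
(j - i)`; legs land on the other side and involve `row`. -/
theorem diag_shape : diag (shape a b B) = boundaryDiag a b B := by
  refine diag_eq_of_mem_iff (boundaryDiag_nonneg B) fun i j => ?_
  rw [← YoungDiagram.mem_cells]
  simp only [shape, complement, Finset.mem_filter, Finset.mem_product, Finset.mem_range]
  have hcol : ∀ n : ℕ, ∀ c : ℤ,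
      (∃ k : Fin B.r, (k : ℕ) = n ∧ (B.col k : ℤ) ≤ c) ↔ (n : ℤ) < colCount B c := by
    intro n c
    constructor
    · rintro ⟨k, rfl, hk⟩
      exact (lt_colCount_iff B k c).2 hk
    · intro h
      have := colCount_le B c
      exact ⟨⟨n, by omega⟩, rfl, (lt_colCount_iff B ⟨n, by omega⟩ c).1 h⟩
  have hrow : ∀ n : ℕ, ∀ c : ℤ,
      (∃ k : Fin B.r, (k : ℕ) = n ∧ (B.row k : ℤ) ≤ c) ↔ (n : ℤ) < rowCount B c := by
    intro n c
    constructor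
    · rintro ⟨k, rfl, hk⟩
      exact (lt_rowCount_iff B k c).2 hk
    · intro h
      have := rowCount_le B c
      exact ⟨⟨n, by omega⟩, rfl, (lt_rowCount_iff B ⟨n, by omega⟩ c).1 h⟩
  have hc0 := colCount_nonneg B (a + (j - i))
  have hr0 := rowCount_nonneg B (b - (j - i))
  have hc1 := @colCount_of_nonpos a b B (a + (j - i))
  have hr1 := @rowCount_of_nonpos a b B (b - (j - i))
  by_cases hin : i < a ∧ j < b
  · have h1 : (∃ k : Fin B.r, (k : ℕ) = a - 1 - i ∧ a - 1 - i ≤ b - 1 - j ∧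
        b - 1 - j - (a - 1 - i) ≤ b - B.col k) ↔
        (j : ℤ) - i ≤ b - a ∧ ((a - 1 - i : ℕ) : ℤ) < colCount B (a + (j - i)) := by
      rw [← hcol]
      constructor
      · rintro ⟨k, h2, h3, h4⟩
        have := B.col_le k
        exact ⟨by omega, k, h2, by omega⟩
      · rintro ⟨h3, k, h2, h4⟩
        have := B.col_le k
        exact ⟨k, h2, by omega, by omega⟩
    have h2 : (∃ k : Fin B.r, (k : ℕ) = b - 1 - j ∧ b - 1 - j ≤ a - 1 - i ∧
        a - 1 - i - (b - 1 - j) ≤ a - B.row k) ↔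
        (b : ℤ) - a ≤ j - i ∧ ((b - 1 - j : ℕ) : ℤ) < rowCount B (b - (j - i)) := by
      rw [← hrow]
      constructor
      · rintro ⟨k, h2, h3, h4⟩
        have := B.row_le k
        exact ⟨by omega, k, h2, by omega⟩
      · rintro ⟨h3, k, h2, h4⟩
        have := B.row_le k
        exact ⟨k, h2, by omega, by omega⟩
    refine (and_congr_right fun _ => not_congr
      ((mem_frobenius_iff _ _ _ _ _ _).trans (or_congr h1 h2))).trans ?_
    rw [boundaryDiag]
    -- Content `b - a` is the Frobenius diagonal and falls under both descriptions.
    have heq : (j : ℤ) - i = b - a →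
        colCount B (a + (j - i)) = rowCount B (b - (j - i)) := by
      intro h
      rw [colCount_of_le B (by omega), rowCount_of_le B (by omega)]
    split_ifs with hc
    · omega
    · omega
  · rw [boundaryDiag]
    split_ifs with hc <;> omega

end Shape

theorem OPl_bijOn (a b : ℕ) (B : BoundaryPair a b) (l : ℕ) :
    Set.BijOn height (OPl a b B l) {h | IsHeight a b B h ∧ (heightExc a b h).encard = l} := by
  have h := height_bijOn a b B
  refine ⟨fun P hP => ⟨h.mapsTo hP.1, ?_⟩, h.injOn.mono fun P hP => hP.1, ?_⟩
  · rw [← vacOsc_eq hP.1, hP.2]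
  · rintro _ ⟨H, hl⟩
    obtain ⟨P, hP, rfl⟩ := h.surjOn H
    exact ⟨P, ⟨hP, by rw [vacOsc_eq hP, hl]⟩, rfl⟩

end Osculating

theorem corollary14 (a b : ℕ) (ha : 0 < a) (hb : 0 < b) (B : Osculating.BoundaryPair a b) (l : ℕ)
    (prec : ℤ → ℤ → Prop) (hprec : Osculating.IsQOrder ((b : ℤ) - (a : ℤ)) prec) :
    (Osculating.OPl a b B l).Finite ∧
    (Osculating.OT (Osculating.shape a b B) l).Finite ∧
    (Osculating.OPl a b B l).ncard =
      ∑ᶠ η ∈ Osculating.OT (Osculating.shape a b B) l,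
        Nat.choose (min a b + Osculating.asc prec η) l := by
  open Osculating in
  have := hprec.isStrictTotalOrder
  -- Radius `a + b` suffices for the arrays; the extra `l` ensures that every letter of a word of
  -- length `l` occurs in the block.
  obtain ⟨bl, hmem, hbl⟩ := exists_block prec
    (Finset.Icc (-((a + b + l : ℕ) : ℤ)) ((a + b + l : ℕ) : ℤ))
  have hbij := (toArray_bijOn a b B l (a + b + l) (by omega)).comp (OPl_bijOn a b B l)
  rw [← walks_positions hprec hmem hbl] at hbij
  obtain ⟨hfin, hcard⟩ := ncard_walks (positions bl (min a b))
    (nodup_positions (nodup_of_pairwise_prec hbl) _) (boundaryDiag a b B) l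
  have hword := word_bijOn (shape a b B) l
  rw [diag_shape] at hword
  refine ⟨Set.Finite.of_finite_image (hbij.image_eq ▸ hfin) hbij.injOn,
    Set.Finite.of_finite_image (hword.image_eq ▸ words_finite _ _) hword.injOn, ?_⟩
  rw [← hbij.injOn.ncard_image, hbij.image_eq, hcard]
  symm
  refine finsum_mem_eq_of_bijOn word hword fun η hη => ?_
  obtain ⟨hl, hs⟩ := hword.mapsTo hη
  rw [emb_positions hbl, hl, asc_eq_ascW]
  intro c hc
  have := hs.abs_le c hc
  rw [hmem, Finset.mem_Icc, ← abs_le]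
  push_cast
  omega
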